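/- \textbf{Setting.} Let $\beta,d,\eta>0$. For ${\bf t}=(x,y)\neq 0$ let $G_{\rm MB}({\bf t})=-\frac{1}{2\pi\beta^2}\left[K_0(\beta|{\bf t}|)-\log(1/|{\bf t}|)\right]$, where $K_0(z)=\int_0^\infty e^{-z\cosh u}\,du$ is the modified Bessel function, and let the modified Stokeslet be $${\bf G}({\bf t})=\begin{pmatrix}-\partial_{yy}&\partial_{xy}\\ \partial_{xy}&-\partial_{xx}\end{pmatrix}G_{\rm MB}({\bf t}).$$ For $\xi\in\mathbb R$ put ${\bf e}_1=(d,0)$, ${\bf e}_2=(\xi,\eta)$, ${\bf l}_{mn}=m{\bf e}_1+n{\bf e}_2$, $\mathcal C=\{a{\bf e}_1+b{\bf e}_2: a,b\in[-\frac12,\frac12]\}$. In the singly periodic case ($i=1$) assume $\xi=0$ and set $p=2$, $J=\{0\}$; in the doubly periodic case ($i=2$) assume $\sqrt{\xi^2+\eta^2}\le d$ and set $p=4$, $J=\{-1,0,1\}$. For ${\bf t}=(x,y)$, ${\bf s}=(x',y')\in\mathcal C$ define $${\bf K}_i^{west}({\bf t},{\bf s})=\sum_{n\in J}\sum_{m\le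 -p}{\bf G}({\bf t}-({\bf s}+{\bf l}_{mn})),\qquad {\bf K}_i^{east}({\bf t},{\bf s})=\sum_{n\in J}\sum_{m\ge p}{\bf G}({\bf t}-({\bf s}+{\bf l}_{mn})).$$ Write $\chi=\sqrt{\lambda^2+\beta^2}$ and $$M_\beta(\lambda)=\begin{bmatrix}-\lambda^2/\chi& i\lambda\\ i\lambda&\chi\end{bmatrix},\quad M_0(\lambda)=\begin{bmatrix}|\lambda|&-i\lambda\\-i\lambda&-|\lambda|\end{bmatrix},\quad \kappa_\beta(\lambda)=\chi,\quad \kappa_0(\lambda)=|\lambda|,$$ and, for $\nu\in\{\beta,0\}$ and $\kappa=\kappa_\nu(\lambda)$, $$F_{i,\nu}({\bf t},{\bf s};\lambda)=\frac{1}{4\pi\beta^2}\sum_{n\in J}e^{-\kappa(x-x'-n\xi)+i\lambda(y-y'-n\eta)}\,\frac{e^{-p\kappa d}}{1-e^{-\kappa d}}\,M_\nu(\lambda).$$ A \emph{quadrature rule of precision $\epsilon$} for $F_{i,\nu}$ consists of finitely many real nodes $\lambda_n$ and real weights $w_n$, $n=1,\dots,N$ (with all $\lambda_n\ne0$ if $\nu=0$),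 such that for all ${\bf t},{\bf s}\in\mathcal C$ every entry of $\mathrm{Re}\left(\int_{-\infty}^\infty F_{i,\nu}\,d\lambda-\sum_n w_nF_{i,\nu}({\bf t},{\bf s};\lambda_n)\right)$ has absolute value at most $\epsilon$. Real parts are compared, so that rules on $[0,\infty)$ with doubled weights are included. \textbf{Theorem.} Let $i\in\{1,2\}$. (a) The series defining ${\bf K}_i^{west}$ and ${\bf K}_i^{east}$ converge absolutely on $\mathcal C\times\mathcal C$, the functions $F_{i,\beta}$, $F_{i,0}$ are integrable in $\lambda\in\mathbb R$, and $${\bf K}_i^{west}({\bf t},{\bf s})=\int_{-\infty}^\infty F_{i,\beta}({\bf t},{\bf s};\lambda)\,d\lambda+\int_{-\infty}^\infty F_{i,0}({\bf t},{\bf s};\lambda)\,d\lambda .$$ (b) For every $\epsilon>0$ there are quadrature rules of precision $\epsilon$ for $F_{i,\beta}$ and for $F_{i,0}$. They depend on $\beta,d,\eta,\epsilon$ only; for $i=2$ the same rules serve all $\xi$ with $\sqrt{\xi^2+\eta^2}\le d$. (c) Let $\epsilon>0$, and let $\{w_{n,\nu},\lambda_{n,\nu}\}_{n=1}^{N_\nu}$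 be any quadrature rules of precision $\epsilon$ for $F_{i,\nu}$, $\nu\in\{\beta,0\}$. Let ${\bf t}_l=(x_l,y_l)$, $l=1,\dots,N_T$, and ${\bf s}_j=(x'_j,y'_j)$, $j=1,\dots,N_S$, lie in $\mathcal C$, and let ${\bf P}_i^{west}$, ${\bf P}_i^{east}$ be the $N_T\times N_S$ block matrices with $2\times2$ blocks ${\bf K}_i^{west}({\bf t}_l,{\bf s}_j)$, ${\bf K}_i^{east}({\bf t}_l,{\bf s}_j)$. With $\lambda_n=\lambda_{n,\nu}$ and $\kappa_n=\kappa_\nu(\lambda_{n,\nu})$, let ${\bf L}_{i,\nu}^{west}$, ${\bf R}_{i,\nu}^{west}$ be the block matrices and ${\bf D}_{i,\nu}^{west}$ the block diagonal matrix with $2\times 2$ blocks $${\bf L}_{i,\nu}^{west}(l,n)=e^{-\kappa_nx_l}e^{i\lambda_ny_l}{\bf I}_2,\qquad {\bf R}_{i,\nu}^{west}(n,j)=e^{\kappa_nx'_j}e^{-i\lambda_ny'_j}{\bf I}_2,$$ $${\bf D}_{i,\nu}^{west}(n,n)=\frac{w_{n,\nu}}{4\pi\beta^2}\,B_{i,n}\,\frac{e^{-p\kappa_nd}}{1-e^{-\kappa_nd}}\,M_\nu(\lambda_n),$$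 where $B_{1,n}=1$ and $B_{2,n}=e^{-\kappa_n\xi+i\lambda_n\eta}+e^{\kappa_n\xi-i\lambda_n\eta}+1$. Let ${\bf L}_{i,\nu}^{east}$, ${\bf R}_{i,\nu}^{east}$ be obtained by replacing $x_l$ by $-x_l$ and $x'_j$ by $-x'_j$, and let ${\bf D}_{i,\nu}^{east}=\overline{{\bf D}_{i,\nu}^{west}}$. Then for $\ast\in\{west,east\}$ every entry of $${\bf P}_i^{\ast}-\mathrm{Re}\left({\bf L}_{i,\beta}^{\ast}{\bf D}_{i,\beta}^{\ast}{\bf R}_{i,\beta}^{\ast}+{\bf L}_{i,0}^{\ast}{\bf D}_{i,0}^{\ast}{\bf R}_{i,0}^{\ast}\right)$$ has absolute value at most $2\epsilon$. Consequently, for every real strength vector ${\bf q}\in\mathbb R^{2N_S}$, each component of the potential ${\bf P}_i^\ast{\bf q}$ differs from that of the real part of the factorized operator applied to ${\bf q}$ by at most $2\epsilon\sum_j|q_j|$. -/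

import Mathlib

open MeasureTheory

noncomputable section

namespace PeriodicMS

/-! ### The modified Stokeslet -/

/-- The modified Bessel function of the second kind of order zero, for positive argument. -/
def besselK0 (z : ℝ) : ℝ := ∫ u in Set.Ioi (0 : ℝ), Real.exp (-(z * Real.cosh u))

/-- Euclidean length of a point of the plane. -/
def len (t : ℝ × ℝ) : ℝ := Real.sqrt (t.1 ^ 2 + t.2 ^ 2)

/-- The modified biharmonic Green's function. -/
def greenMB (β : ℝ) (t : ℝ × ℝ) : ℝ :=
  -(1 / (2 * Real.pi * β ^ 2)) * (besselK0 (β * len t) - Real.log (1 / len t))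

/-- Partial derivative in the first coordinate. -/
def dX (f : ℝ × ℝ → ℝ) (t : ℝ × ℝ) : ℝ := deriv (fun u => f (u, t.2)) t.1

/-- Partial derivative in the second coordinate. -/
def dY (f : ℝ × ℝ → ℝ) (t : ℝ × ℝ) : ℝ := deriv (fun v => f (t.1, v)) t.2

/-- The modified Stokeslet `(∇ ⊗ ∇ - Δ I) greenMB`. -/
def stokeslet (β : ℝ) (t : ℝ × ℝ) : Matrix (Fin 2) (Fin 2) ℝ :=
  !![-dY (dY (greenMB β)) t, dX (dY (greenMB β)) t;
     dX (dY (greenMB β)) t, -dX (dX (greenMB β)) t]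

/-! ### Unit cell, lattice and the west and east kernels -/

/-- The unit cell spanned by `e₁ = (d, 0)` and `e₂ = (ξ, η)`, centred at the origin. -/
def cell (d ξ η : ℝ) : Set (ℝ × ℝ) :=
  {t | ∃ a ∈ Set.Icc (-(1 / 2) : ℝ) (1 / 2), ∃ b ∈ Set.Icc (-(1 / 2) : ℝ) (1 / 2),
    t = (a * d + b * ξ, b * η)}

/-- The lattice vector `m e₁ + n e₂`. -/
def latticeVec (d ξ η : ℝ) (p : ℤ × ℤ) : ℝ × ℝ := (p.1 * d + p.2 * ξ, p.2 * η)

/-- The field at `t` due to the image of the source `s` in the cell `p`. -/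
def image (β d ξ η : ℝ) (t s : ℝ × ℝ) (p : ℤ × ℤ) : Matrix (Fin 2) (Fin 2) ℝ :=
  stokeslet β (t - (s + latticeVec d ξ η p))

/-- Image cells to the west, singly periodic. -/
def west1 : Set (ℤ × ℤ) := {p | p.1 ≤ -2 ∧ p.2 = 0}

/-- Image cells to the east, singly periodic. -/
def east1 : Set (ℤ × ℤ) := {p | 2 ≤ p.1 ∧ p.2 = 0}

/-- Image cells to the west, doubly periodic. -/
def west2 : Set (ℤ × ℤ) := {p | p.1 ≤ -4 ∧ -1 ≤ p.2 ∧ p.2 ≤ 1}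

/-- Image cells to the east, doubly periodic. -/
def east2 : Set (ℤ × ℤ) := {p | 4 ≤ p.1 ∧ -1 ≤ p.2 ∧ p.2 ≤ 1}

/-- The kernel `K(t,s)`: the field of all images of `s` in the cells of `Λ`. -/
def kernel (Λ : Set (ℤ × ℤ)) (β d ξ η : ℝ) (t s : ℝ × ℝ) : Matrix (Fin 2) (Fin 2) ℝ :=
  ∑' p : Λ, image β d ξ η t s p

/-- The matrix with `2 × 2` blocks `K(t_l, s_j)`. -/
def periodizing (Λ : Set (ℤ × ℤ)) (β d ξ η : ℝ) {NT NS : ℕ}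
    (T : Fin NT → ℝ × ℝ) (S : Fin NS → ℝ × ℝ) :
    Matrix (Fin NT × Fin 2) (Fin NS × Fin 2) ℝ :=
  Matrix.comp _ _ _ _ _ (Matrix.of fun l j => kernel Λ β d ξ η (T l) (S j))

/-! ### The two plane-wave integrands -/

/-- `√(λ² + β²)`. -/
def chi (β lam : ℝ) : ℝ := Real.sqrt (lam ^ 2 + β ^ 2)

/-- The `2 × 2` matrix of the plane-wave integral with decay rate `√(λ² + β²)`. -/
def symbB (β lam : ℝ) : Matrix (Fin 2) (Fin 2) ℂ :=
  !![-((lam ^ 2 / chi β lam : ℝ) : ℂ), Complex.I * lam;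
     Complex.I * lam, (chi β lam : ℂ)]

/-- The `2 × 2` matrix of the plane-wave integral with decay rate `|λ|`. -/
def symbZ (lam : ℝ) : Matrix (Fin 2) (Fin 2) ℂ :=
  !![((|lam| : ℝ) : ℂ), -(Complex.I * lam);
     -(Complex.I * lam), -((|lam| : ℝ) : ℂ)]

/-- `e^{-p κ d} / (1 - e^{-κ d})`. -/
def geo (p : ℕ) (κ d : ℝ) : ℝ := Real.exp (-(p * κ * d)) / (1 - Real.exp (-(κ * d)))

/-- The plane wave `e^{-κ x + i λ y}`. -/
def wave (κ lam x y : ℝ) : ℂ := Complex.exp (-(κ * x : ℝ) + Complex.I * (lam * y : ℝ))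

/-- Integrand of either plane-wave integral of the singly periodic west kernel;
`κ` and `A` are `√(λ² + β²)` and `symbB`, or `|λ|` and `symbZ`. -/
def integrand1 (β d : ℝ) (κ : ℝ → ℝ) (A : ℝ → Matrix (Fin 2) (Fin 2) ℂ)
    (t s : ℝ × ℝ) (lam : ℝ) : Matrix (Fin 2) (Fin 2) ℂ :=
  (1 / (4 * Real.pi * β ^ 2) * wave (κ lam) lam (t.1 - s.1) (t.2 - s.2)
    * (geo 2 (κ lam) d : ℂ)) • A lam

/-- Integrand of either plane-wave integral of the doubly periodic west kernel. -/
def integrand2 (β d ξ η : ℝ) (κ : ℝ → ℝ) (A : ℝ → Matrix (Fin 2) (Fin 2) ℂ)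
    (t s : ℝ × ℝ) (lam : ℝ) : Matrix (Fin 2) (Fin 2) ℂ :=
  (1 / (4 * Real.pi * β ^ 2)
    * (∑ n ∈ Finset.Icc (-1 : ℤ) 1,
        wave (κ lam) lam (t.1 - s.1 - n * ξ) (t.2 - s.2 - n * η))
    * (geo 4 (κ lam) d : ℂ)) • A lam

/-! ### Quadrature rules -/

/-- A quadrature rule on the line: finitely many real nodes and real weights. -/
structure Rule where
  /-- number of nodes -/
  N : ℕ
  /-- nodes -/
  node : Fin N → ℝ
  /-- weights -/
  weight : Fin N → ℝ

/-- The rule `Q` integrates the matrix-valued function `F t s` over the real line to precision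
`ε`, up to an imaginary error, uniformly over targets `t` and sources `s` in `C`.
Only real parts are compared, so that rules on the half line with
doubled weights are included. -/
def Rule.Precise (Q : Rule) (ε : ℝ) (C : Set (ℝ × ℝ))
    (F : ℝ × ℝ → ℝ × ℝ → ℝ → Matrix (Fin 2) (Fin 2) ℂ) : Prop :=
  ∀ t ∈ C, ∀ s ∈ C, ∀ a b : Fin 2,
    |(∫ lam : ℝ, F t s lam a b).re
      - (∑ n, (Q.weight n : ℂ) * F t s (Q.node n) a b).re| ≤ ε

/-! ### The factors -/

/-- `L(l,n) = e^{-κ_n x_l} e^{i λ_n y_l} I₂`. -/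
def leftFactor (κ : ℝ → ℝ) (Q : Rule) {NT : ℕ} (T : Fin NT → ℝ × ℝ) :
    Matrix (Fin NT × Fin 2) (Fin Q.N × Fin 2) ℂ :=
  Matrix.comp _ _ _ _ _ (Matrix.of fun l n =>
    wave (κ (Q.node n)) (Q.node n) (T l).1 (T l).2 • (1 : Matrix (Fin 2) (Fin 2) ℂ))

/-- `R(n,j) = e^{κ_n x'_j} e^{-i λ_n y'_j} I₂`. -/
def rightFactor (κ : ℝ → ℝ) (Q : Rule) {NS : ℕ} (S : Fin NS → ℝ × ℝ) :
    Matrix (Fin Q.N × Fin 2) (Fin NS × Fin 2) ℂ :=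
  Matrix.comp _ _ _ _ _ (Matrix.of fun n j =>
    wave (κ (Q.node n)) (Q.node n) (-(S j).1) (-(S j).2) • (1 : Matrix (Fin 2) (Fin 2) ℂ))

/-- Block diagonal matrix, singly periodic west. -/
def diag1 (β d : ℝ) (κ : ℝ → ℝ) (A : ℝ → Matrix (Fin 2) (Fin 2) ℂ) (Q : Rule) :
    Matrix (Fin Q.N × Fin 2) (Fin Q.N × Fin 2) ℂ :=
  Matrix.comp _ _ _ _ _ (Matrix.diagonal fun n =>
    ((Q.weight n : ℂ) / (4 * Real.pi * β ^ 2) * (geo 2 (κ (Q.node n)) d : ℂ)) • A (Q.node n))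

/-- `e^{-κ ξ + i λ η} + e^{κ ξ - i λ η} + 1`. -/
def bracket (κ lam ξ η : ℝ) : ℂ := wave κ lam ξ η + wave κ lam (-ξ) (-η) + 1

/-- Block diagonal matrix, doubly periodic west. -/
def diag2 (β d ξ η : ℝ) (κ : ℝ → ℝ) (A : ℝ → Matrix (Fin 2) (Fin 2) ℂ) (Q : Rule) :
    Matrix (Fin Q.N × Fin 2) (Fin Q.N × Fin 2) ℂ :=
  Matrix.comp _ _ _ _ _ (Matrix.diagonal fun n =>
    ((Q.weight n : ℂ) / (4 * Real.pi * β ^ 2) * bracket (κ (Q.node n)) (Q.node n) ξ η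
      * (geo 4 (κ (Q.node n)) d : ℂ)) • A (Q.node n))

/-- The reflection `x ↦ -x` of a family of points. -/
def reflect {N : ℕ} (T : Fin N → ℝ × ℝ) : Fin N → ℝ × ℝ := fun l => (-(T l).1, (T l).2)

/-- Entrywise complex conjugate. -/
def conjM {m n : Type*} (D : Matrix m n ℂ) : Matrix m n ℂ := D.map (starRingEnd ℂ)

variable {NT NS : ℕ}

/-- `L_{1,β} D_{1,β} R_{1,β} + L_1 D_1 R_1`, west. -/
def lowRankWest1 (β d : ℝ) (QB QZ : Rule) (T : Fin NT → ℝ × ℝ) (S : Fin NS → ℝ × ℝ) :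
    Matrix (Fin NT × Fin 2) (Fin NS × Fin 2) ℂ :=
  leftFactor (chi β) QB T * diag1 β d (chi β) (symbB β) QB * rightFactor (chi β) QB S
  + leftFactor abs QZ T * diag1 β d abs symbZ QZ * rightFactor abs QZ S

/-- The same for the east: `x ↦ -x` in `L` and `R`, and conjugated `D`. -/
def lowRankEast1 (β d : ℝ) (QB QZ : Rule) (T : Fin NT → ℝ × ℝ) (S : Fin NS → ℝ × ℝ) :
    Matrix (Fin NT × Fin 2) (Fin NS × Fin 2) ℂ :=
  leftFactor (chi β) QB (reflect T) * conjM (diag1 β d (chi β) (symbB β) QB)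
      * rightFactor (chi β) QB (reflect S)
  + leftFactor abs QZ (reflect T) * conjM (diag1 β d abs symbZ QZ)
      * rightFactor abs QZ (reflect S)

/-- `L_{2,β} D_{2,β} R_{2,β} + L_2 D_2 R_2`, west. -/
def lowRankWest2 (β d ξ η : ℝ) (QB QZ : Rule) (T : Fin NT → ℝ × ℝ) (S : Fin NS → ℝ × ℝ) :
    Matrix (Fin NT × Fin 2) (Fin NS × Fin 2) ℂ :=
  leftFactor (chi β) QB T * diag2 β d ξ η (chi β) (symbB β) QB * rightFactor (chi β) QB S
  + leftFactor abs QZ T * diag2 β d ξ η abs symbZ QZ * rightFactor abs QZ S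

/-- The same for the east. -/
def lowRankEast2 (β d ξ η : ℝ) (QB QZ : Rule) (T : Fin NT → ℝ × ℝ) (S : Fin NS → ℝ × ℝ) :
    Matrix (Fin NT × Fin 2) (Fin NS × Fin 2) ℂ :=
  leftFactor (chi β) QB (reflect T) * conjM (diag2 β d ξ η (chi β) (symbB β) QB)
      * rightFactor (chi β) QB (reflect S)
  + leftFactor abs QZ (reflect T) * conjM (diag2 β d ξ η abs symbZ QZ)
      * rightFactor abs QZ (reflect S)

/-- The real part of `F` reproduces the operator `P` to precision `ε` in every entry, and the
real part of `F q` reproduces the potential `P q` to precision `ε ∑ |q_j|` for all real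
strengths `q`. -/
def RealPartApprox (P : Matrix (Fin NT × Fin 2) (Fin NS × Fin 2) ℝ)
    (F : Matrix (Fin NT × Fin 2) (Fin NS × Fin 2) ℂ) (ε : ℝ) : Prop :=
  (∀ i j, |P i j - (F i j).re| ≤ ε) ∧
  ∀ (q : Fin NS × Fin 2 → ℝ) (i : Fin NT × Fin 2),
    |P.mulVec q i - (F.mulVec (fun j => (q j : ℂ)) i).re| ≤ ε * ∑ j, |q j|

end PeriodicMS

end

noncomputable section

namespace PeriodicMS

open Filter Topology Set ComplexConjugate MeasureTheory

/-! ### Plane waves -/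

/-! For `x > 0` the modified Stokeslet is a superposition of the plane waves e^{-κx+iλy}. The Bessel
part comes from ∫ e^{-χx+iλy}/χ dλ = 2 K₀(β|(x,y)|): in polar coordinates the angular derivative of
the integrand is -i times the λ-derivative of the plane wave, so the integral depends on the radius
only, and on the axis λ = β sinh v turns it into K₀. The logarithm has no such integral, since 1/|λ|
is not integrable at 0, but its x-derivative has: ∫ e^{-|λ|x+iλy} dλ = 2x/(x²+y²). Two
differentiations under the integral sign produce the symbols M_β and M_0
(`stokeslet_eq_waveIntegral`).

Moving the image by d multiplies a plane wave by e^{-κd}, so the sum over m ≤ -p is a geometric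
series. The choice of p keeps every image at horizontal distance at least d (`Separated`), and
κe^{-κd}/(1-e^{-κd}) ≤ e^{-κd/2}/d dominates everything, including the singularity at λ = 0. This
gives convergence, integrability and the exchange of sum and integral (`hasSum_waveIntegral`). East
follows from west because the Stokeslet is even and the row set is symmetric: K^east(t,s) =
K^west(s,t).

Quadrature rules exist because the integrand depends on a parameter (a,b,ξ) in a compact set, is
jointly continuous away from λ = 0 and has an integrable majorant; a Riemann sum with a fine mesh
then works uniformly (`exists_rule_of_dominated`). The factorization is the multiplicativity of
plane waves, and 2ε is the sum of the errors of the two integrals. Both periodic cases are instances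
of one argument for a finite symmetric row set `J` and an offset `p`. -/

theorem norm_wave (κ lam x y : ℝ) : ‖wave κ lam x y‖ = Real.exp (-(κ * x)) := by
  simp [wave, Complex.norm_exp]

theorem wave_add (κ lam x y x' y' : ℝ) :
    wave κ lam (x + x') (y + y') = wave κ lam x y * wave κ lam x' y' := by
  simp only [wave, ← Complex.exp_add]
  congr 1
  push_cast
  ring

theorem conj_wave (κ lam x y : ℝ) : conj (wave κ lam x y) = wave κ lam x (-y) := by
  simp only [wave, ← Complex.exp_conj]
  congr 1
  simp

theorem wave_neg (κ lam x y : ℝ) : wave κ (-lam) x y = wave κ lam x (-y) := by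
  simp [wave]

theorem wave_zero_right (κ lam x : ℝ) : wave κ lam x 0 = (Real.exp (-(κ * x)) : ℂ) := by
  simp [wave]

theorem hasDerivAt_wave_fst (κ lam x y : ℝ) :
    HasDerivAt (fun u => wave κ lam u y) (-(κ : ℂ) * wave κ lam x y) x := by
  have h : HasDerivAt (fun u : ℝ => (-(κ * u : ℝ) + Complex.I * (lam * y : ℝ) : ℂ))
      (-(κ : ℂ)) x := by
    have h1 := ((hasDerivAt_id x).const_mul κ).ofReal_comp
    simpa using (h1.neg).add_const (Complex.I * (lam * y : ℝ))
  simpa [wave, mul_comm] using h.cexp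

theorem hasDerivAt_wave_snd (κ lam x y : ℝ) :
    HasDerivAt (fun v => wave κ lam x v) (Complex.I * lam * wave κ lam x y) y := by
  have h : HasDerivAt (fun v : ℝ => (-(κ * x : ℝ) + Complex.I * (lam * v : ℝ) : ℂ))
      (Complex.I * lam) y := by
    have h1 := ((hasDerivAt_id y).const_mul lam).ofReal_comp
    simpa using (h1.const_mul Complex.I).const_add (-(κ * x : ℝ) : ℂ)
  simpa [wave, mul_comm] using h.cexp

theorem continuous_wave {X : Type*} [TopologicalSpace X] {κ lam x y : X → ℝ} (hκ : Continuous κ)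
    (hl : Continuous lam) (hx : Continuous x) (hy : Continuous y) :
    Continuous fun q => wave (κ q) (lam q) (x q) (y q) := by
  unfold wave
  fun_prop

/-! ### Decay in the spectral variable -/

theorem integrable_exp_neg_mul_abs {s : ℝ} (hs : 0 < s) :
    Integrable fun lam : ℝ => Real.exp (-(s * |lam|)) := by
  rw [← integrableOn_univ, ← Iic_union_Ioi (a := (0 : ℝ)), integrableOn_union]
  constructor
  · refine (integrableOn_exp_mul_Iic hs 0).congr_fun (fun l hl => ?_) measurableSet_Iic
    simp [abs_of_nonpos (mem_Iic.1 hl)]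
  · refine (integrableOn_exp_mul_Ioi (neg_neg_of_pos hs) 0).congr_fun (fun l hl => ?_)
      measurableSet_Ioi
    simp [abs_of_pos (mem_Ioi.1 hl)]

/-- Half of the exponential pays for the factor `u`; this absorbs the κ that each differentiation
produces. -/
theorem mul_exp_neg_le {s : ℝ} (hs : 0 < s) (u : ℝ) :
    u * Real.exp (-(u * s)) ≤ 2 / s * Real.exp (-(u * s / 2)) := by
  have h1 : Real.exp (-(u * s)) = Real.exp (-(u * s / 2)) * Real.exp (-(u * s / 2)) := by
    rw [← Real.exp_add]; ring_nf
  have h2 : u * s / 2 * Real.exp (-(u * s / 2)) ≤ 1 := by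
    have := Real.add_one_le_exp (u * s / 2)
    rw [Real.exp_neg, ← div_eq_mul_inv, div_le_one (Real.exp_pos _)]
    linarith
  calc u * Real.exp (-(u * s))
      = 2 / s * Real.exp (-(u * s / 2)) * (u * s / 2 * Real.exp (-(u * s / 2))) := by
        rw [h1]; field_simp
    _ ≤ 2 / s * Real.exp (-(u * s / 2)) * 1 := by gcongr
    _ = _ := mul_one _

/-- Admissible decay rates of plane waves. -/
structure DecayRate (κ : ℝ → ℝ) : Prop where
  cont : Continuous κ
  abs_le : ∀ l, |l| ≤ κ l
  even : ∀ l, κ (-l) = κ l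

theorem DecayRate.nonneg {κ : ℝ → ℝ} (h : DecayRate κ) (l : ℝ) : 0 ≤ κ l :=
  (abs_nonneg l).trans (h.abs_le l)

theorem DecayRate.pos {κ : ℝ → ℝ} (h : DecayRate κ) {l : ℝ} (hl : l ≠ 0) : 0 < κ l :=
  (abs_pos.2 hl).trans_le (h.abs_le l)

theorem decayRate_abs : DecayRate abs := ⟨continuous_abs, fun _ => le_rfl, abs_neg⟩

theorem decayRate_chi (β : ℝ) : DecayRate (chi β) where
  cont := by unfold chi; fun_prop
  abs_le l := Real.abs_le_sqrt (by nlinarith [sq_nonneg β])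
  even l := by simp [chi]

theorem chi_pos {β : ℝ} (hβ : 0 < β) (l : ℝ) : 0 < chi β l :=
  Real.sqrt_pos.2 (by positivity)

theorem le_chi (β l : ℝ) : β ≤ chi β l :=
  Real.le_sqrt_of_sq_le (by nlinarith [sq_nonneg l])

theorem chi_sq (β l : ℝ) : chi β l ^ 2 = l ^ 2 + β ^ 2 :=
  Real.sq_sqrt (by positivity)

/-- The superposition of plane waves with amplitude `c`. -/
def waveIntegral (κ : ℝ → ℝ) (c : ℝ → ℂ) (x y : ℝ) : ℂ := ∫ l, c l * wave (κ l) l x y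

/-! ### Differentiation of wave superpositions under the integral sign. -/

section

variable {κ : ℝ → ℝ} {c : ℝ → ℂ} {C x : ℝ}

theorem aestronglyMeasurable_mul_wave (hκ : DecayRate κ) (hc : AEStronglyMeasurable c) (x y : ℝ) :
    AEStronglyMeasurable fun l => c l * wave (κ l) l x y :=
  hc.mul (continuous_wave hκ.cont continuous_id continuous_const
    continuous_const).aestronglyMeasurable

theorem norm_mul_wave_le (hκ : DecayRate κ) (hC : ∀ l, ‖c l‖ ≤ C) (hx : 0 ≤ x) (y l : ℝ) :
    ‖c l * wave (κ l) l x y‖ ≤ C * Real.exp (-(x * |l|)) := by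
  have hC0 : 0 ≤ C := (norm_nonneg _).trans (hC 0)
  rw [norm_mul, norm_wave]
  have := hκ.abs_le l
  refine mul_le_mul (hC l) (Real.exp_le_exp.2 ?_) (Real.exp_nonneg _) hC0
  nlinarith

theorem norm_mul_wave_le' (hκ : DecayRate κ) (hC0 : 0 ≤ C) (hC : ∀ l, ‖c l‖ ≤ C * κ l) {s : ℝ}
    (hs : 0 < s) (hx : s ≤ x) (y l : ℝ) :
    ‖c l * wave (κ l) l x y‖ ≤ C * (2 / s) * Real.exp (-(s / 2 * |l|)) := by
  rw [norm_mul, norm_wave]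
  have h := hκ.abs_le l
  have h0 := hκ.nonneg l
  calc ‖c l‖ * Real.exp (-(κ l * x)) ≤ C * κ l * Real.exp (-(κ l * s)) := by
        gcongr
        exact hC l
    _ = C * (κ l * Real.exp (-(κ l * s))) := by ring
    _ ≤ C * (2 / s * Real.exp (-(κ l * s / 2))) := by
        exact mul_le_mul_of_nonneg_left (mul_exp_neg_le hs _) hC0
    _ ≤ C * (2 / s * Real.exp (-(s / 2 * |l|))) := by
        gcongr
        nlinarith
    _ = _ := by ring

theorem integrable_mul_wave (hκ : DecayRate κ) (hc : AEStronglyMeasurable c)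
    (hC : ∀ l, ‖c l‖ ≤ C) (hx : 0 < x) (y : ℝ) : Integrable fun l => c l * wave (κ l) l x y :=
  ((integrable_exp_neg_mul_abs hx).const_mul C).mono' (aestronglyMeasurable_mul_wave hκ hc x y)
    (Eventually.of_forall fun l => norm_mul_wave_le hκ hC hx.le y l)

/-- The amplitude must be bounded before differentiation, but afterwards it is only bounded by `C *
κ`. This allows two derivatives starting from 1/χ, as the amplitudes -1 and iλ/χ of the first
derivatives are still bounded. -/
theorem hasDerivAt_waveIntegral_fst (hκ : DecayRate κ) (hc : AEStronglyMeasurable c)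
    (hC : ∀ l, ‖c l‖ ≤ C) (hx : 0 < x) (y : ℝ) :
    HasDerivAt (fun u => waveIntegral κ c u y)
      (waveIntegral κ (fun l => -(κ l : ℂ) * c l) x y) x := by
  have hC0 : 0 ≤ C := (norm_nonneg _).trans (hC 0)
  have hm : AEStronglyMeasurable fun l => -(κ l : ℂ) * c l :=
    (Complex.continuous_ofReal.comp hκ.cont).neg.aestronglyMeasurable.mul hc
  have hb : ∀ l, ‖-(κ l : ℂ) * c l‖ ≤ C * κ l := fun l => by
    rw [norm_mul, norm_neg, Complex.norm_real, Real.norm_of_nonneg (hκ.nonneg l), mul_comm]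
    exact mul_le_mul_of_nonneg_right (hC l) (hκ.nonneg l)
  refine (hasDerivAt_integral_of_dominated_loc_of_deriv_le
    (F := fun u l => c l * wave (κ l) l u y) (F' := fun u l => -(κ l : ℂ) * c l * wave (κ l) l u y)
    -- On `u > x / 2` the derivative has a majorant independent of `u`.
    (Ioi_mem_nhds (half_lt_self hx))
    (Eventually.of_forall fun u => aestronglyMeasurable_mul_wave hκ hc u y)
    (integrable_mul_wave hκ hc hC hx y) (aestronglyMeasurable_mul_wave hκ hm x y)
    (Eventually.of_forall fun l u hu =>
      norm_mul_wave_le' hκ hC0 hb (half_pos hx) (le_of_lt hu) y l)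
    ((integrable_exp_neg_mul_abs (half_pos (half_pos hx))).const_mul _)
    (Eventually.of_forall fun l u _ => ?_)).2
  have := (hasDerivAt_wave_fst (κ l) l u y).const_mul (c l)
  exact this.congr_deriv (by ring)

theorem hasDerivAt_waveIntegral_snd (hκ : DecayRate κ) (hc : AEStronglyMeasurable c)
    (hC : ∀ l, ‖c l‖ ≤ C) (hx : 0 < x) (y : ℝ) :
    HasDerivAt (fun v => waveIntegral κ c x v)
      (waveIntegral κ (fun l => Complex.I * l * c l) x y) y := by
  have hC0 : 0 ≤ C := (norm_nonneg _).trans (hC 0)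
  have hm : AEStronglyMeasurable fun l : ℝ => Complex.I * l * c l :=
    (continuous_const.mul Complex.continuous_ofReal).aestronglyMeasurable.mul hc
  have hb : ∀ l : ℝ, ‖Complex.I * l * c l‖ ≤ C * κ l := fun l => by
    rw [norm_mul, norm_mul, Complex.norm_I, one_mul, Complex.norm_real, Real.norm_eq_abs, mul_comm]
    exact mul_le_mul (hC l) (hκ.abs_le l) (abs_nonneg l) hC0
  refine (hasDerivAt_integral_of_dominated_loc_of_deriv_le
    (F := fun v l => c l * wave (κ l) l x v)
    (F' := fun v l => Complex.I * l * c l * wave (κ l) l x v) univ_mem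
    (Eventually.of_forall fun v => aestronglyMeasurable_mul_wave hκ hc x v)
    (integrable_mul_wave hκ hc hC hx y) (aestronglyMeasurable_mul_wave hκ hm x y)
    (Eventually.of_forall fun l v _ => norm_mul_wave_le' hκ hC0 hb hx le_rfl v l)
    ((integrable_exp_neg_mul_abs (half_pos hx)).const_mul _)
    (Eventually.of_forall fun l v _ => ?_)).2
  have := (hasDerivAt_wave_snd (κ l) l x v).const_mul (c l)
  exact this.congr_deriv (by ring)

end

/-- The integral of a function with Hermitian symmetry is real. -/
theorem im_integral_eq_zero {f : ℝ → ℂ} (hf : ∀ l, conj (f (-l)) = f l) :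
    (∫ l, f l).im = 0 := by
  rw [← Complex.conj_eq_iff_im, ← integral_conj]
  calc ∫ l, conj (f l) = ∫ l, conj (f (-l)) := (integral_neg_eq_self (fun l => conj (f l)) _).symm
    _ = _ := by simp_rw [hf]

/-- The Green's function is real, so its derivatives are computed through real parts; Hermitian
symmetry of the amplitude shows that nothing is lost. -/
theorem ofReal_re_waveIntegral {κ : ℝ → ℝ} (hκ : DecayRate κ) {c : ℝ → ℂ}
    (hc : ∀ l, conj (c (-l)) = c l) (x y : ℝ) :
    ((waveIntegral κ c x y).re : ℂ) = waveIntegral κ c x y := by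
  have h : (waveIntegral κ c x y).im = 0 := im_integral_eq_zero fun l => by
    rw [map_mul, hc, conj_wave, wave_neg, hκ.even, neg_neg]
  exact Complex.ext rfl (by simp [h])

/-! ### The Bessel function as a superposition of plane waves -/

theorem hasDerivAt_chi {β : ℝ} (hβ : 0 < β) (l : ℝ) : HasDerivAt (chi β) (l / chi β l) l := by
  have h : HasDerivAt (fun u : ℝ => u ^ 2 + β ^ 2) (2 * l) l := by
    simpa using (hasDerivAt_pow 2 l).add_const (β ^ 2)
  refine (h.sqrt (by positivity)).congr_deriv ?_
  rw [chi, mul_div_mul_left _ _ two_ne_zero]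

theorem hasDerivAt_wave_chi {β : ℝ} (hβ : 0 < β) (x y l : ℝ) :
    HasDerivAt (fun l => wave (chi β l) l x y)
      ((-((l / chi β l * x : ℝ) : ℂ) + Complex.I * y) * wave (chi β l) l x y) l := by
  have h1 := ((hasDerivAt_chi hβ l).mul_const x).ofReal_comp
  have h2 := ((hasDerivAt_id l).mul_const y).ofReal_comp.const_mul Complex.I
  have h := (h1.neg.add h2).cexp
  simpa [wave, mul_comm] using h

theorem norm_coe_div_chi_le {β : ℝ} (hβ : 0 < β) (l : ℝ) : ‖((l / chi β l : ℝ) : ℂ)‖ ≤ 1 := by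
  rw [Complex.norm_real, Real.norm_eq_abs, abs_div, abs_of_pos (chi_pos hβ l)]
  exact div_le_one_of_le₀ ((decayRate_chi β).abs_le l) (chi_pos hβ l).le

theorem continuous_inv_chi {β : ℝ} (hβ : 0 < β) :
    Continuous fun l : ℝ => ((1 / chi β l : ℝ) : ℂ) :=
  Complex.continuous_ofReal.comp
    (continuous_const.div (decayRate_chi β).cont fun l => (chi_pos hβ l).ne')

theorem norm_inv_chi_le {β : ℝ} (hβ : 0 < β) (l : ℝ) : ‖((1 / chi β l : ℝ) : ℂ)‖ ≤ 1 / β := by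
  rw [Complex.norm_real, Real.norm_of_nonneg (one_div_nonneg.2 (chi_pos hβ l).le)]
  exact one_div_le_one_div_of_le hβ (le_chi β l)

theorem continuous_div_chi {β : ℝ} (hβ : 0 < β) :
    Continuous fun l : ℝ => ((l / chi β l : ℝ) : ℂ) :=
  Complex.continuous_ofReal.comp
    (continuous_id.div (decayRate_chi β).cont fun l => (chi_pos hβ l).ne')

/-- Rotating the point differentiates the integrand into an exact λ-derivative, whose integral over
the line vanishes. The condition on cos θ keeps the point in the half plane of convergence. -/
theorem hasDerivAt_waveIntegral_rotate {β r θ : ℝ} (hβ : 0 < β) (hr : 0 < r)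
    (hθ : 0 < Real.cos θ) :
    HasDerivAt (fun φ => waveIntegral (chi β) (fun l => ((1 / chi β l : ℝ) : ℂ))
      (r * Real.cos φ) (r * Real.sin φ)) 0 θ := by
  have hκ := decayRate_chi β
  -- The amplitude of the φ-derivative: the factor χ from the exponent cancels 1/χ. It equals -i
  -- times the amplitude in `hasDerivAt_wave_chi`.
  let a : ℝ → ℝ → ℂ := fun φ l =>
    (r * Real.sin φ : ℝ) + Complex.I * ((l / chi β l : ℝ) * (r * Real.cos φ : ℝ))
  have ha : ∀ φ l, ‖a φ l‖ ≤ 2 * r := fun φ l => by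
    refine (norm_add_le _ _).trans ?_
    have h1 : ‖((r * Real.sin φ : ℝ) : ℂ)‖ ≤ r := by
      rw [Complex.norm_real, Real.norm_eq_abs, abs_mul, abs_of_pos hr]
      exact mul_le_of_le_one_right hr.le (Real.abs_sin_le_one φ)
    have h2 : ‖((r * Real.cos φ : ℝ) : ℂ)‖ ≤ r := by
      rw [Complex.norm_real, Real.norm_eq_abs, abs_mul, abs_of_pos hr]
      exact mul_le_of_le_one_right hr.le (Real.abs_cos_le_one φ)
    rw [norm_mul, norm_mul, Complex.norm_I, one_mul, two_mul]
    exact add_le_add h1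
      ((mul_le_of_le_one_left (norm_nonneg _) (norm_coe_div_chi_le hβ l)).trans h2)
  have hac : ∀ φ, Continuous (a φ) := fun φ =>
    continuous_const.add (continuous_const.mul ((continuous_div_chi hβ).mul continuous_const))
  have hs : 0 < r * Real.cos θ := mul_pos hr hθ
  have hopen : {φ | r * Real.cos θ / 2 < r * Real.cos φ} ∈ 𝓝 θ :=
    (isOpen_lt continuous_const (by fun_prop)).mem_nhds (half_lt_self hs)
  have key := hasDerivAt_integral_of_dominated_loc_of_deriv_le
    (F := fun φ l => ((1 / chi β l : ℝ) : ℂ) *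
      wave (chi β l) l (r * Real.cos φ) (r * Real.sin φ))
    (F' := fun φ l => a φ l * wave (chi β l) l (r * Real.cos φ) (r * Real.sin φ))
    (bound := fun l => 2 * r * Real.exp (-(r * Real.cos θ / 2 * |l|)))
    (μ := volume) hopen
    (Eventually.of_forall fun φ =>
      aestronglyMeasurable_mul_wave hκ (continuous_inv_chi hβ).aestronglyMeasurable _ _)
    (integrable_mul_wave hκ (continuous_inv_chi hβ).aestronglyMeasurable (norm_inv_chi_le hβ) hs _)
    (aestronglyMeasurable_mul_wave hκ (hac θ).aestronglyMeasurable _ _)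
    (Eventually.of_forall fun l φ hφ => ?_)
    ((integrable_exp_neg_mul_abs (half_pos hs)).const_mul _)
    (Eventually.of_forall fun l φ _ => ?_)
  · refine key.2.congr_deriv ?_
    have h0 : ∫ l, (-((l / chi β l * (r * Real.cos θ) : ℝ) : ℂ)
        + Complex.I * (r * Real.sin θ : ℝ)) *
          wave (chi β l) l (r * Real.cos θ) (r * Real.sin θ) = 0 := by
      -- Integrability of the wave and of its λ-derivative removes the boundary terms at infinity.
      refine integral_eq_zero_of_hasDerivAt_of_integrable
        (fun l => hasDerivAt_wave_chi hβ _ _ l) ?_ ?_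
      · refine (key.1.const_mul Complex.I).congr (Eventually.of_forall fun l => ?_)
        simp only [a]
        push_cast
        ring_nf
        rw [Complex.I_sq]
        ring
      · simpa using integrable_mul_wave hκ (c := fun _ => 1) (C := 1)
          aestronglyMeasurable_const (by simp) hs (r * Real.sin θ)
    have h1 := congrArg (fun z => -Complex.I * z) h0
    simp only [mul_zero, ← integral_const_mul] at h1
    rw [← h1]
    congr 1
    ext l
    simp only [a]
    push_cast
    ring_nf
    rw [Complex.I_sq]
    ring
  · have hφ' : r * Real.cos θ / 2 < r * Real.cos φ := hφ
    refine (norm_mul_wave_le hκ (ha φ) ((half_pos hs).trans hφ').le _ l).trans ?_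
    gcongr
  · have h1 := (((Real.hasDerivAt_cos φ).const_mul r).const_mul (chi β l)).ofReal_comp
    have h2 := (((Real.hasDerivAt_sin φ).const_mul r).const_mul l).ofReal_comp.const_mul Complex.I
    have h := ((h1.neg.add h2).cexp).const_mul ((1 / chi β l : ℝ) : ℂ)
    refine (h.congr_deriv ?_)
    simp only [a, wave]
    have hχ : (chi β l : ℂ) ≠ 0 := Complex.ofReal_ne_zero.2 (chi_pos hβ l).ne'
    push_cast
    field_simp
    simp
    ring_nf

theorem waveIntegral_chi_axis {β r : ℝ} (hβ : 0 < β) :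
    waveIntegral (chi β) (fun l => ((1 / chi β l : ℝ) : ℂ)) r 0 = (2 * besselK0 (β * r) : ℝ) := by
  have h1 : ∀ l, ((1 / chi β l : ℝ) : ℂ) * wave (chi β l) l r 0
      = ((1 / chi β l * Real.exp (-(chi β l * r)) : ℝ) : ℂ) := fun l => by
    rw [wave_zero_right]; push_cast; ring
  have hrange : (fun v => β * Real.sinh v) '' univ = univ := by
    rw [image_univ]
    exact ((mul_left_surjective₀ hβ.ne').comp Real.sinh_surjective).range_eq
  -- Substitution λ = β sinh v: then χ = β cosh v, and the Jacobian cancels 1/χ.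
  have h2 : ∫ l, 1 / chi β l * Real.exp (-(chi β l * r))
      = ∫ v, Real.exp (-(β * r * Real.cosh v)) := by
    have := integral_image_eq_integral_abs_deriv_smul (s := univ) MeasurableSet.univ
      (f := fun v => β * Real.sinh v) (f' := fun v => β * Real.cosh v)
      (fun v _ => ((Real.hasDerivAt_sinh v).const_mul β).hasDerivWithinAt)
      (((mul_right_injective₀ hβ.ne').comp Real.sinh_injective).injOn)
      (fun l => 1 / chi β l * Real.exp (-(chi β l * r)))
    rw [hrange, setIntegral_univ, setIntegral_univ] at this
    rw [this]
    congr 1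
    ext v
    have hc : 0 < β * Real.cosh v := mul_pos hβ (Real.cosh_pos v)
    have hchi : chi β (β * Real.sinh v) = β * Real.cosh v := by
      rw [chi, ← Real.sqrt_sq hc.le]
      congr 1
      linear_combination -β ^ 2 * Real.cosh_sq v
    rw [hchi, abs_of_pos hc, smul_eq_mul, ← mul_assoc, mul_one_div_cancel hc.ne', one_mul]
    congr 1
    ring
  rw [waveIntegral]
  simp_rw [h1]
  rw [integral_complex_ofReal, h2, besselK0]
  have h3 := integral_comp_abs (f := fun v => Real.exp (-(β * r * Real.cosh v)))
  simp only [Real.cosh_abs] at h3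
  rw [h3]

theorem waveIntegral_chi_eq_besselK0 {β x y : ℝ} (hβ : 0 < β) (hx : 0 < x) :
    waveIntegral (chi β) (fun l => ((1 / chi β l : ℝ) : ℂ)) x y
      = (2 * besselK0 (β * len (x, y)) : ℝ) := by
  let z : ℂ := ⟨x, y⟩
  have hz : ‖z‖ = len (x, y) := by
    rw [Complex.norm_def, Complex.normSq_apply, len]
    simp only [z, sq]
  have hz0 : z ≠ 0 := fun h => hx.ne' (congrArg Complex.re h)
  have hr : 0 < ‖z‖ := norm_pos_iff.2 hz0
  have hI : ∀ θ ∈ Ioo (-(Real.pi / 2)) (Real.pi / 2), HasDerivAt _ _ θ := fun θ hθ =>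
    hasDerivAt_waveIntegral_rotate hβ hr (Real.cos_pos_of_mem_Ioo hθ)
  -- Since `x > 0`, the angle can be turned to 0 without leaving the interval on which the
  -- derivative vanishes.
  have harg : z.arg ∈ Ioo (-(Real.pi / 2)) (Real.pi / 2) := by
    exact abs_lt.1 (Complex.abs_arg_lt_pi_div_two_iff.2 (Or.inl hx))
  have := isOpen_Ioo.is_const_of_deriv_eq_zero isPreconnected_Ioo
    (fun θ hθ => (hI θ hθ).differentiableAt.differentiableWithinAt)
    (fun θ hθ => (hI θ hθ).deriv) harg
    (show (0 : ℝ) ∈ _ from ⟨by linarith [Real.pi_pos], by linarith [Real.pi_pos]⟩)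
  simp only [Complex.norm_mul_cos_arg, Complex.norm_mul_sin_arg, Real.cos_zero, Real.sin_zero,
    mul_one, mul_zero] at this
  rw [waveIntegral_chi_axis hβ, hz] at this
  exact this

/-! ### The modified Stokeslet as a superposition of plane waves -/

/-- The two half lines contribute 1/(x+iy) and 1/(x-iy). The sum is the x-derivative of log(x²+y²),
the first stage at which the logarithmic part has a plane-wave integral. -/
theorem waveIntegral_abs_one {x : ℝ} (hx : 0 < x) (y : ℝ) :
    waveIntegral abs (fun _ => 1) x y = (2 * x / (x ^ 2 + y ^ 2) : ℝ) := by
  have hint : Integrable fun l : ℝ => (1 : ℂ) * wave |l| l x y :=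
    integrable_mul_wave decayRate_abs (c := fun _ => 1) (C := 1) aestronglyMeasurable_const
      (by simp) hx y
  have h1 : ∫ l in Iic (0 : ℝ), (1 : ℂ) * wave |l| l x y = 1 / (x + Complex.I * y) := by
    rw [setIntegral_congr_fun (g := fun l : ℝ => Complex.exp ((x + Complex.I * y) * l))
      measurableSet_Iic, integral_exp_mul_complex_Iic (by simpa using hx)]
    · simp
    · intro l hl
      simp only [one_mul, wave, abs_of_nonpos (mem_Iic.1 hl)]
      congr 1
      push_cast
      ring
  have h2 : ∫ l in Ioi (0 : ℝ), (1 : ℂ) * wave |l| l x y = 1 / (x - Complex.I * y) := by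
    rw [setIntegral_congr_fun (g := fun l : ℝ => Complex.exp (-(x - Complex.I * y) * l))
      measurableSet_Ioi, integral_exp_mul_complex_Ioi (by simpa using hx)]
    · simp
      rw [← neg_sub, div_neg, neg_div, neg_neg, one_div]
    · intro l hl
      simp only [one_mul, wave, abs_of_pos (mem_Ioi.1 hl)]
      congr 1
      push_cast
      ring
  have hp : (x + Complex.I * y : ℂ) ≠ 0 := fun h => hx.ne' (by simpa using congrArg Complex.re h)
  have hm : (x - Complex.I * y : ℂ) ≠ 0 := fun h => hx.ne' (by simpa using congrArg Complex.re h)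
  have hxy : ((x : ℂ) ^ 2 + (y : ℂ) ^ 2) = (x + Complex.I * y) * (x - Complex.I * y) := by
    linear_combination (y : ℂ) ^ 2 * Complex.I_sq
  rw [waveIntegral, ← intervalIntegral.integral_Iic_add_Ioi hint.integrableOn hint.integrableOn,
    h1, h2]
  push_cast
  rw [hxy]
  field_simp
  ring

theorem hasDerivAt_re {f : ℝ → ℂ} {f' : ℂ} {x : ℝ} (h : HasDerivAt f f' x) :
    HasDerivAt (fun u => (f u).re) f'.re x :=
  Complex.reCLM.hasFDerivAt.comp_hasDerivAt x h

/-! ### Derivatives of the logarithm and of the Green's function in the right half plane. -/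

section

variable {x : ℝ} (y : ℝ)

theorem sq_add_sq_pos (hx : 0 < x) : 0 < x ^ 2 + y ^ 2 := by positivity

theorem hasDerivAt_div_normSq_fst (a b : ℝ) (hx : 0 < x) :
    HasDerivAt (fun u => (a * u + b) / (u ^ 2 + y ^ 2))
      ((a * (x ^ 2 + y ^ 2) - (a * x + b) * (2 * x)) / (x ^ 2 + y ^ 2) ^ 2) x := by
  have h1 : HasDerivAt (fun u : ℝ => a * u + b) a x := by
    simpa using ((hasDerivAt_id x).const_mul a).add_const b
  have h2 : HasDerivAt (fun u : ℝ => u ^ 2 + y ^ 2) (2 * x) x := by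
    simpa using (hasDerivAt_pow 2 x).add_const (y ^ 2)
  exact h1.div h2 (sq_add_sq_pos y hx).ne'

theorem hasDerivAt_div_normSq_snd (a b : ℝ) (hx : 0 < x) :
    HasDerivAt (fun v => (a * v + b) / (x ^ 2 + v ^ 2))
      ((a * (x ^ 2 + y ^ 2) - (a * y + b) * (2 * y)) / (x ^ 2 + y ^ 2) ^ 2) y := by
  have h1 : HasDerivAt (fun u : ℝ => a * u + b) a y := by
    simpa using ((hasDerivAt_id y).const_mul a).add_const b
  have h2 : HasDerivAt (fun v : ℝ => x ^ 2 + v ^ 2) (2 * y) y := by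
    simpa using (hasDerivAt_pow 2 y).const_add (x ^ 2)
  exact h1.div h2 (sq_add_sq_pos y hx).ne'

theorem hasDerivAt_log_normSq_fst (hx : 0 < x) :
    HasDerivAt (fun u => Real.log (u ^ 2 + y ^ 2)) (2 * x / (x ^ 2 + y ^ 2)) x := by
  have h2 : HasDerivAt (fun u : ℝ => u ^ 2 + y ^ 2) (2 * x) x := by
    simpa using (hasDerivAt_pow 2 x).add_const (y ^ 2)
  exact h2.log (sq_add_sq_pos y hx).ne'

theorem hasDerivAt_log_normSq_snd (hx : 0 < x) :
    HasDerivAt (fun v => Real.log (x ^ 2 + v ^ 2)) (2 * y / (x ^ 2 + y ^ 2)) y := by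
  have h2 : HasDerivAt (fun v : ℝ => x ^ 2 + v ^ 2) (2 * y) y := by
    simpa using (hasDerivAt_pow 2 y).const_add (x ^ 2)
  exact h2.log (sq_add_sq_pos y hx).ne'

/-- Differentiating the closed form and differentiating under the integral must agree, by uniqueness
of derivatives. -/
theorem waveIntegral_abs_fst (hx : 0 < x) :
    waveIntegral abs (fun l => -(|l| : ℝ)) x y
      = (2 * (y ^ 2 - x ^ 2) / (x ^ 2 + y ^ 2) ^ 2 : ℝ) := by
  have h1 := hasDerivAt_waveIntegral_fst decayRate_abs (c := fun _ => 1) (C := 1)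
    aestronglyMeasurable_const (by simp) hx y
  have h2 := (hasDerivAt_div_normSq_fst y 2 0 hx).ofReal_comp
  have h3 : (fun u => waveIntegral abs (fun _ => 1) u y)
      =ᶠ[𝓝 x] fun u => (((2 * u + 0) / (u ^ 2 + y ^ 2) : ℝ) : ℂ) := by
    filter_upwards [Ioi_mem_nhds hx] with u hu
    rw [waveIntegral_abs_one hu, add_zero]
  have h4 := h1.unique (h2.congr_of_eventuallyEq h3)
  simp only [mul_one] at h4
  rw [h4]
  congr 2
  ring

theorem waveIntegral_abs_snd (hx : 0 < x) :
    waveIntegral abs (fun l => Complex.I * l) x y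
      = (-(4 * x * y) / (x ^ 2 + y ^ 2) ^ 2 : ℝ) := by
  have h1 := hasDerivAt_waveIntegral_snd decayRate_abs (c := fun _ => 1) (C := 1)
    aestronglyMeasurable_const (by simp) hx y
  have h2 := (hasDerivAt_div_normSq_snd y 0 (2 * x) hx).ofReal_comp
  have h3 : (fun v => waveIntegral abs (fun _ => 1) x v)
      = fun v => (((0 * v + 2 * x) / (x ^ 2 + v ^ 2) : ℝ) : ℂ) := by
    ext v
    rw [waveIntegral_abs_one hx, zero_mul, zero_add]
  rw [h3] at h1
  have h4 := h1.unique h2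
  simp only [mul_one] at h4
  rw [h4]
  congr 2
  ring

theorem waveIntegral_neg (κ : ℝ → ℝ) (c : ℝ → ℂ) (x y : ℝ) :
    waveIntegral κ (fun l => -c l) x y = -waveIntegral κ c x y := by
  simp [waveIntegral, integral_neg]

/-- The inverse of `chi β` as an amplitude. -/
def invChi (β l : ℝ) : ℂ := ((1 / chi β l : ℝ) : ℂ)

theorem greenMB_eq {β : ℝ} (hβ : 0 < β) (hx : 0 < x) :
    greenMB β (x, y) = -(1 / (4 * Real.pi * β ^ 2))
      * ((waveIntegral (chi β) (invChi β) x y).re + Real.log (x ^ 2 + y ^ 2)) := by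
  have h : waveIntegral (chi β) (invChi β) x y = (2 * besselK0 (β * len (x, y)) : ℝ) :=
    waveIntegral_chi_eq_besselK0 hβ hx
  have hl : Real.log (1 / len (x, y)) = -(Real.log (x ^ 2 + y ^ 2) / 2) := by
    rw [one_div, Real.log_inv, len, Real.log_sqrt (sq_add_sq_pos y hx).le]
  rw [h, Complex.ofReal_re, greenMB, hl]
  ring

variable {β : ℝ}

theorem aestronglyMeasurable_invChi (hβ : 0 < β) : AEStronglyMeasurable (invChi β) :=
  (continuous_inv_chi hβ).aestronglyMeasurable

theorem continuous_I_mul_invChi (hβ : 0 < β) :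
    Continuous fun l : ℝ => Complex.I * l * invChi β l :=
  (continuous_const.mul Complex.continuous_ofReal).mul (continuous_inv_chi hβ)

theorem norm_I_mul_invChi_le (hβ : 0 < β) (l : ℝ) : ‖Complex.I * l * invChi β l‖ ≤ 1 := by
  have : Complex.I * l * invChi β l = Complex.I * ((l / chi β l : ℝ) : ℂ) := by
    rw [invChi]
    push_cast
    ring
  rw [this, norm_mul, Complex.norm_I, one_mul]
  exact norm_coe_div_chi_le hβ l

theorem chi_mul_invChi (hβ : 0 < β) (l : ℝ) : (chi β l : ℂ) * invChi β l = 1 := by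
  rw [invChi, ← Complex.ofReal_mul, mul_one_div_cancel (chi_pos hβ l).ne', Complex.ofReal_one]

theorem dX_greenMB (hβ : 0 < β) (hx : 0 < x) :
    dX (greenMB β) (x, y) = -(1 / (4 * Real.pi * β ^ 2))
      * ((waveIntegral (chi β) (fun _ => -1) x y).re + 2 * x / (x ^ 2 + y ^ 2)) := by
  have h1 := hasDerivAt_re (hasDerivAt_waveIntegral_fst (decayRate_chi β)
    (aestronglyMeasurable_invChi hβ) (norm_inv_chi_le hβ) hx y)
  have h2 := (h1.add (hasDerivAt_log_normSq_fst y hx)).const_mul (-(1 / (4 * Real.pi * β ^ 2)))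
  simp only [neg_mul, chi_mul_invChi hβ] at h2 ⊢
  rw [dX]
  refine (h2.congr_of_eventuallyEq ?_).deriv
  filter_upwards [Ioi_mem_nhds hx] with u hu
  simp [greenMB_eq y hβ hu]

theorem dY_greenMB (hβ : 0 < β) (hx : 0 < x) :
    dY (greenMB β) (x, y) = -(1 / (4 * Real.pi * β ^ 2))
      * ((waveIntegral (chi β) (fun l => Complex.I * l * invChi β l) x y).re
        + 2 * y / (x ^ 2 + y ^ 2)) := by
  have h1 := hasDerivAt_re (hasDerivAt_waveIntegral_snd (decayRate_chi β)
    (aestronglyMeasurable_invChi hβ) (norm_inv_chi_le hβ) hx y)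
  have h2 := (h1.add (hasDerivAt_log_normSq_snd y hx)).const_mul (-(1 / (4 * Real.pi * β ^ 2)))
  rw [dY]
  refine (h2.congr_of_eventuallyEq (Eventually.of_forall fun v => ?_)).deriv
  simp [greenMB_eq v hβ hx]

/-- Each x-derivative multiplies the amplitude by -χ and each y-derivative by iλ, so 1/χ becomes χ
here, -iλ in the mixed case and -λ²/χ for two y-derivatives. -/
theorem dX_dX_greenMB (hβ : 0 < β) (hx : 0 < x) :
    dX (dX (greenMB β)) (x, y) = -(1 / (4 * Real.pi * β ^ 2))
      * ((waveIntegral (chi β) (fun l => (chi β l : ℂ)) x y).re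
        + 2 * (y ^ 2 - x ^ 2) / (x ^ 2 + y ^ 2) ^ 2) := by
  have h1 := hasDerivAt_re (hasDerivAt_waveIntegral_fst (decayRate_chi β) (c := fun _ => -1)
    (C := 1) aestronglyMeasurable_const (by simp) hx y)
  have h2 := (h1.add (hasDerivAt_div_normSq_fst y 2 0 hx)).const_mul
    (-(1 / (4 * Real.pi * β ^ 2)))
  rw [dX]
  have h3 := (h2.congr_of_eventuallyEq (f₁ := fun u => dX (greenMB β) (u, y)) ?_).deriv
  · refine h3.trans ?_
    simp only [mul_neg_one, neg_neg]
    congr 3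
    ring
  -- The formula for the first derivative is available only for positive `u`, hence only near `x`;
  -- in the second coordinate it holds everywhere.
  filter_upwards [Ioi_mem_nhds hx] with u hu
  simp [dX_greenMB y hβ hu]

theorem dX_dY_greenMB (hβ : 0 < β) (hx : 0 < x) :
    dX (dY (greenMB β)) (x, y) = -(1 / (4 * Real.pi * β ^ 2))
      * ((waveIntegral (chi β) (fun l => -(Complex.I * l)) x y).re
        + -(4 * x * y) / (x ^ 2 + y ^ 2) ^ 2) := by
  have h1 := hasDerivAt_re (hasDerivAt_waveIntegral_fst (decayRate_chi β)
    (continuous_I_mul_invChi hβ).aestronglyMeasurable (norm_I_mul_invChi_le hβ) hx y)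
  have h2 := (h1.add (hasDerivAt_div_normSq_fst y 0 (2 * y) hx)).const_mul
    (-(1 / (4 * Real.pi * β ^ 2)))
  rw [dX]
  have h3 := (h2.congr_of_eventuallyEq (f₁ := fun u => dY (greenMB β) (u, y)) ?_).deriv
  · refine h3.trans ?_
    have h4 : ∀ l : ℝ, -(chi β l : ℂ) * (Complex.I * l * invChi β l) = -(Complex.I * l) :=
      fun l => by linear_combination -(Complex.I * l) * chi_mul_invChi hβ l
    simp only [h4]
    congr 3
    ring
  filter_upwards [Ioi_mem_nhds hx] with u hu
  simp [dY_greenMB y hβ hu]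

theorem dY_dY_greenMB (hβ : 0 < β) (hx : 0 < x) :
    dY (dY (greenMB β)) (x, y) = -(1 / (4 * Real.pi * β ^ 2))
      * ((waveIntegral (chi β) (fun l => -((l ^ 2 / chi β l : ℝ) : ℂ)) x y).re
        + 2 * (x ^ 2 - y ^ 2) / (x ^ 2 + y ^ 2) ^ 2) := by
  have h1 := hasDerivAt_re (hasDerivAt_waveIntegral_snd (decayRate_chi β)
    (continuous_I_mul_invChi hβ).aestronglyMeasurable (norm_I_mul_invChi_le hβ) hx y)
  have h2 := (h1.add (hasDerivAt_div_normSq_snd y 2 0 hx)).const_mul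
    (-(1 / (4 * Real.pi * β ^ 2)))
  rw [dY]
  have h3 := (h2.congr_of_eventuallyEq (f₁ := fun v => dY (greenMB β) (x, v)) ?_).deriv
  · refine h3.trans ?_
    have h4 : ∀ l : ℝ, Complex.I * l * (Complex.I * l * invChi β l)
        = -((l ^ 2 / chi β l : ℝ) : ℂ) := fun l => by
      rw [invChi]
      push_cast
      linear_combination (l : ℂ) ^ 2 / chi β l * Complex.I_sq
    simp only [h4]
    congr 3
    ring
  exact Eventually.of_forall fun v => by simp [dY_greenMB v hβ hx]

end

theorem conj_symbB_neg (β l : ℝ) (a b : Fin 2) : conj (symbB β (-l) a b) = symbB β l a b := by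
  fin_cases a <;> fin_cases b <;> simp [symbB, chi, Complex.conj_ofReal]

/-- Entry by entry, the Bessel part gives `symbB` and the second derivatives of the logarithm give
`symbZ`, which is minus the formal limit of `symbB` as β → 0. -/
theorem stokeslet_eq_waveIntegral {β x : ℝ} (hβ : 0 < β) (hx : 0 < x) (y : ℝ) (a b : Fin 2) :
    (stokeslet β (x, y) a b : ℂ) = 1 / (4 * Real.pi * β ^ 2)
      * (waveIntegral (chi β) (fun l => symbB β l a b) x y
        + waveIntegral abs (fun l => symbZ l a b) x y) := by
  have hre := ofReal_re_waveIntegral (decayRate_chi β) (c := fun l => symbB β l a b)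
    (fun l => conj_symbB_neg β l a b) x y
  have h1 := waveIntegral_abs_fst y hx
  have h2 := waveIntegral_abs_snd y hx
  rw [← hre]
  fin_cases a <;> fin_cases b
  · have h3 : waveIntegral abs (fun l => symbZ l 0 0) x y
        = (-(2 * (y ^ 2 - x ^ 2) / (x ^ 2 + y ^ 2) ^ 2) : ℝ) := by
      rw [Complex.ofReal_neg, ← h1, ← waveIntegral_neg]
      simp [symbZ]
    have h4 : stokeslet β (x, y) 0 0 = 1 / (4 * Real.pi * β ^ 2)
        * ((waveIntegral (chi β) (fun l => symbB β l 0 0) x y).re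
          + -(2 * (y ^ 2 - x ^ 2) / (x ^ 2 + y ^ 2) ^ 2)) := by
      simp only [stokeslet, symbB, Matrix.of_apply, Matrix.cons_val_zero, Matrix.cons_val',
        dY_dY_greenMB y hβ hx]
      ring
    simp only [Fin.mk_zero]
    rw [h3, h4]
    push_cast
    rfl
  · have h3 : waveIntegral abs (fun l => symbZ l 0 1) x y
        = (-(-(4 * x * y) / (x ^ 2 + y ^ 2) ^ 2) : ℝ) := by
      rw [Complex.ofReal_neg, ← h2, ← waveIntegral_neg]
      simp [symbZ]
    have h4 : stokeslet β (x, y) 0 1 = 1 / (4 * Real.pi * β ^ 2)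
        * ((waveIntegral (chi β) (fun l => symbB β l 0 1) x y).re
          + -(-(4 * x * y) / (x ^ 2 + y ^ 2) ^ 2)) := by
      simp only [stokeslet, symbB, Matrix.of_apply, Matrix.cons_val_zero, Matrix.cons_val_one,
        Matrix.cons_val', Matrix.cons_val_fin_one, dX_dY_greenMB y hβ hx, waveIntegral_neg,
        Complex.neg_re]
      ring
    simp only [Fin.mk_zero, Fin.mk_one]
    rw [h3, h4]
    push_cast
    rfl
  · have h3 : waveIntegral abs (fun l => symbZ l 1 0) x y
        = (-(-(4 * x * y) / (x ^ 2 + y ^ 2) ^ 2) : ℝ) := by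
      rw [Complex.ofReal_neg, ← h2, ← waveIntegral_neg]
      simp [symbZ]
    have h4 : stokeslet β (x, y) 1 0 = 1 / (4 * Real.pi * β ^ 2)
        * ((waveIntegral (chi β) (fun l => symbB β l 1 0) x y).re
          + -(-(4 * x * y) / (x ^ 2 + y ^ 2) ^ 2)) := by
      simp only [stokeslet, symbB, Matrix.of_apply, Matrix.cons_val_zero, Matrix.cons_val_one,
        Matrix.cons_val', Matrix.cons_val_fin_one, dX_dY_greenMB y hβ hx, waveIntegral_neg,
        Complex.neg_re]
      ring
    simp only [Fin.mk_zero, Fin.mk_one]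
    rw [h3, h4]
    push_cast
    rfl
  · have h3 : waveIntegral abs (fun l => symbZ l 1 1) x y
        = (2 * (y ^ 2 - x ^ 2) / (x ^ 2 + y ^ 2) ^ 2 : ℝ) := by
      rw [← h1]
      simp [symbZ]
    have h4 : stokeslet β (x, y) 1 1 = 1 / (4 * Real.pi * β ^ 2)
        * ((waveIntegral (chi β) (fun l => symbB β l 1 1) x y).re
          + 2 * (y ^ 2 - x ^ 2) / (x ^ 2 + y ^ 2) ^ 2) := by
      simp only [stokeslet, symbB, Matrix.of_apply, Matrix.cons_val_one,
        Matrix.cons_val', Matrix.cons_val_fin_one, dX_dX_greenMB y hβ hx]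
      ring
    simp only [Fin.mk_one]
    rw [h3, h4]
    push_cast
    rfl

/-! ### Lattice sums of plane waves -/

/-- Admissible pairs of a decay rate and a matrix symbol. -/
structure IsSymbol (κ : ℝ → ℝ) (A : ℝ → Matrix (Fin 2) (Fin 2) ℂ) : Prop where
  rate : DecayRate κ
  cont : ∀ a b, Continuous fun l => A l a b
  norm_le : ∀ l a b, ‖A l a b‖ ≤ κ l

theorem isSymbol_symbB {β : ℝ} (hβ : 0 < β) : IsSymbol (chi β) (symbB β) where
  rate := decayRate_chi β
  cont a b := by
    have h1 : Continuous fun l : ℝ => ((l ^ 2 / chi β l : ℝ) : ℂ) :=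
      Complex.continuous_ofReal.comp
        ((continuous_pow 2).div (decayRate_chi β).cont fun l => (chi_pos hβ l).ne')
    have h2 : Continuous fun l : ℝ => (chi β l : ℂ) :=
      Complex.continuous_ofReal.comp (decayRate_chi β).cont
    fin_cases a <;> fin_cases b
    · exact h1.neg
    · exact continuous_const.mul Complex.continuous_ofReal
    · exact continuous_const.mul Complex.continuous_ofReal
    · exact h2
  norm_le l a b := by
    have h0 := chi_pos hβ l
    have h1 := (decayRate_chi β).abs_le l
    have h2 : l ^ 2 / chi β l ≤ chi β l := by
      rw [div_le_iff₀ h0, ← sq, chi_sq]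
      nlinarith [sq_nonneg β]
    have h3 : 0 ≤ l ^ 2 / chi β l := by positivity
    fin_cases a <;> fin_cases b
    · simpa [symbB, -Complex.ofReal_div, -Complex.ofReal_pow, abs_of_nonneg h3,
        abs_of_pos h0] using h2
    · simpa [symbB] using h1
    · simpa [symbB] using h1
    · simp [symbB, abs_of_pos h0]

theorem isSymbol_symbZ : IsSymbol abs symbZ where
  rate := decayRate_abs
  cont a b := by
    have h2 : Continuous fun l : ℝ => ((|l| : ℝ) : ℂ) :=
      Complex.continuous_ofReal.comp continuous_abs
    fin_cases a <;> fin_cases b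
    · exact h2
    · exact (continuous_const.mul Complex.continuous_ofReal).neg
    · exact (continuous_const.mul Complex.continuous_ofReal).neg
    · exact h2.neg
  norm_le l a b := by
    fin_cases a <;> fin_cases b <;> simp [symbZ]

/-- The plane-wave integrand for the image cells with `m ≤ -p` and `n ∈ J`. -/
def cellIntegrand (β d ξ η : ℝ) (J : Finset ℤ) (p : ℕ) (κ : ℝ → ℝ)
    (A : ℝ → Matrix (Fin 2) (Fin 2) ℂ) (t s : ℝ × ℝ) (lam : ℝ) : Matrix (Fin 2) (Fin 2) ℂ :=
  (1 / (4 * Real.pi * β ^ 2)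
    * (∑ n ∈ J, wave (κ lam) lam (t.1 - s.1 - n * ξ) (t.2 - s.2 - n * η))
    * (geo p (κ lam) d : ℂ)) • A lam

/-- The image cells with `m ≤ -p` and `n ∈ J`. -/
def westCells (J : Finset ℤ) (p : ℕ) : Set (ℤ × ℤ) := {q | q.1 ≤ -p ∧ q.2 ∈ J}

/-- The image cells with `p ≤ m` and `n ∈ J`. -/
def eastCells (J : Finset ℤ) (p : ℕ) : Set (ℤ × ℤ) := {q | (p : ℤ) ≤ q.1 ∧ q.2 ∈ J}

/-- All images of `s` in the cells `m ≤ -p`, `n ∈ J` lie to the west of `t` by at least `d`. -/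
def Separated (d ξ : ℝ) (J : Finset ℤ) (p : ℕ) (t s : ℝ × ℝ) : Prop :=
  ∀ n ∈ J, d ≤ t.1 - s.1 - n * ξ + p * d

theorem norm_prefactor (β : ℝ) :
    ‖(1 / (4 * Real.pi * β ^ 2) : ℂ)‖ = 1 / (4 * Real.pi * β ^ 2) := by
  have : (1 / (4 * Real.pi * β ^ 2) : ℂ) = ((1 / (4 * Real.pi * β ^ 2) : ℝ) : ℂ) := by
    push_cast
    rfl
  rw [this, Complex.norm_real, Real.norm_of_nonneg (by positivity)]

/-- The left side is κe^{-κd/2}/(2 sinh(κd/2)), and sinh u ≥ u. The factor κ, supplied by the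
symbol, cancels the pole of the geometric sum at κ = 0. -/
theorem mul_exp_div_le {κ d : ℝ} (hκ : 0 < κ) (hd : 0 < d) :
    κ * (Real.exp (-(κ * d)) / (1 - Real.exp (-(κ * d)))) ≤ 1 / d * Real.exp (-(d / 2 * κ)) := by
  have hu : 0 < κ * d / 2 := by positivity
  have h1 := Real.self_le_sinh_iff.2 hu.le
  rw [Real.sinh_eq] at h1
  have he : Real.exp (-(κ * d)) = Real.exp (-(κ * d / 2)) * Real.exp (-(κ * d / 2)) := by
    rw [← Real.exp_add]; ring_nf
  have hlt : Real.exp (-(κ * d)) < 1 := Real.exp_lt_one_iff.2 (by nlinarith)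
  have h2 : Real.exp (-(κ * d / 2)) * Real.exp (κ * d / 2) = 1 := by
    rw [← Real.exp_add]; simp
  have h3 : Real.exp (-(d / 2 * κ)) = Real.exp (-(κ * d / 2)) := by ring_nf
  rw [h3, ← mul_div_assoc, div_le_iff₀ (by linarith), one_div_mul_eq_div, div_mul_eq_mul_div,
    le_div_iff₀ hd]
  have hE := Real.exp_pos (-(κ * d / 2))
  have h4 : κ * d * Real.exp (-(κ * d / 2)) ≤ 1 - Real.exp (-(κ * d)) := by
    rw [he]; nlinarith
  rw [he] at h4 ⊢
  nlinarith

theorem mul_exp_div_le_abs {κ : ℝ → ℝ} (hκ : DecayRate κ) {d l : ℝ} (hd : 0 < d) (hl : l ≠ 0) :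
    κ l * (Real.exp (-(κ l * d)) / (1 - Real.exp (-(κ l * d))))
      ≤ 1 / d * Real.exp (-(d / 2 * |l|)) := by
  refine (mul_exp_div_le (hκ.pos hl) hd).trans ?_
  have := hκ.abs_le l
  gcongr

theorem hasSum_mul_prod {ι ι' R : Type*} [RCLike R] {f : ι → R} {g : ι' → R} {u v : R}
    (hf : HasSum f u) (hg : HasSum g v) :
    HasSum (fun q : ι × ι' => f q.1 * g q.2) (u * v) :=
  hf.mul hg (summable_mul_of_summable_norm (summable_norm_iff.2 hf.summable)
    (summable_norm_iff.2 hg.summable))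

theorem ae_ne_zero : ∀ᵐ l : ℝ, l ≠ 0 :=
  compl_mem_ae_iff.2 (measure_singleton 0)

/-! ### Domination of the integrand and summation over the image cells. -/

section

variable {β d ξ η : ℝ} {J : Finset ℤ} {p : ℕ} {κ : ℝ → ℝ} {A : ℝ → Matrix (Fin 2) (Fin 2) ℂ}
  {t s : ℝ × ℝ}

theorem norm_cellIntegrand_le (hd : 0 < d) (hA : IsSymbol κ A) (hsep : Separated d ξ J p t s)
    {l : ℝ} (hl : l ≠ 0) (a b : Fin 2) :
    ‖cellIntegrand β d ξ η J p κ A t s l a b‖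
      ≤ 1 / (4 * Real.pi * β ^ 2) * (J.card * (1 / d)) * Real.exp (-(d / 2 * |l|)) := by
  have hκ := hA.rate.pos hl
  have hlt : Real.exp (-(κ l * d)) < 1 := Real.exp_lt_one_iff.2 (by nlinarith)
  have h1 : ∀ n ∈ J, ‖wave (κ l) l (t.1 - s.1 - n * ξ) (t.2 - s.2 - n * η)‖
      ≤ Real.exp (-(κ l * d)) * Real.exp (p * κ l * d) := fun n hn => by
    rw [norm_wave, ← Real.exp_add, Real.exp_le_exp]
    nlinarith [hsep n hn]
  have h2 : ‖∑ n ∈ J, wave (κ l) l (t.1 - s.1 - n * ξ) (t.2 - s.2 - n * η)‖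
      ≤ J.card * (Real.exp (-(κ l * d)) * Real.exp (p * κ l * d)) := by
    simpa using norm_sum_le_of_le J h1
  have h3 : ‖(geo p (κ l) d : ℂ)‖ = Real.exp (-(p * κ l * d)) / (1 - Real.exp (-(κ l * d))) := by
    rw [Complex.norm_real, Real.norm_of_nonneg, geo]
    exact div_nonneg (Real.exp_nonneg _) (by linarith)
  -- The possible growth of the waves is cancelled by the numerator of `geo p`; the separation
  -- leaves a spare factor e^{-κd}.
  have h5 : Real.exp (p * κ l * d) * Real.exp (-(p * κ l * d)) = 1 := by
    rw [← Real.exp_add]; simp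
  rw [cellIntegrand, Matrix.smul_apply, norm_smul, norm_mul, norm_mul, h3, norm_prefactor]
  have hg : 0 ≤ Real.exp (-(p * κ l * d)) / (1 - Real.exp (-(κ l * d))) :=
    div_nonneg (Real.exp_nonneg _) (by linarith)
  calc _ ≤ 1 / (4 * Real.pi * β ^ 2) * (J.card * (Real.exp (-(κ l * d)) * Real.exp (p * κ l * d)))
        * (Real.exp (-(p * κ l * d)) / (1 - Real.exp (-(κ l * d)))) * κ l := by
        gcongr
        exact hA.norm_le l a b
    _ = 1 / (4 * Real.pi * β ^ 2) * (J.card * (κ l * (Real.exp (-(κ l * d))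
        / (1 - Real.exp (-(κ l * d))))))
        * (Real.exp (p * κ l * d) * Real.exp (-(p * κ l * d))) := by ring
    _ ≤ 1 / (4 * Real.pi * β ^ 2) * (J.card * (1 / d * Real.exp (-(d / 2 * |l|)))) := by
        rw [h5, mul_one]
        have := mul_exp_div_le_abs hA.rate hd hl
        exact mul_le_mul_of_nonneg_left (mul_le_mul_of_nonneg_left this (Nat.cast_nonneg _))
          (by positivity)
    _ = _ := by ring

theorem measurable_cellIntegrand (hA : IsSymbol κ A) (a b : Fin 2) :
    Measurable fun l => cellIntegrand β d ξ η J p κ A t s l a b := by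
  have hκ := hA.rate.cont.measurable
  have hAm := (hA.cont a b).measurable
  have hw : ∀ n : ℤ, Measurable fun l =>
      wave (κ l) l (t.1 - s.1 - n * ξ) (t.2 - s.2 - n * η) := fun n =>
    (continuous_wave hA.rate.cont continuous_id continuous_const continuous_const).measurable
  have hs : Measurable fun l =>
      ∑ n ∈ J, wave (κ l) l (t.1 - s.1 - n * ξ) (t.2 - s.2 - n * η) :=
    Finset.measurable_fun_sum J fun n _ => hw n
  have hg : Measurable fun l => (geo p (κ l) d : ℂ) := by
    unfold geo
    fun_prop
  exact ((hs.const_mul _).mul hg).mul hAm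

theorem integrable_cellIntegrand (hd : 0 < d) (hA : IsSymbol κ A)
    (hsep : Separated d ξ J p t s) (a b : Fin 2) :
    Integrable fun l => cellIntegrand β d ξ η J p κ A t s l a b :=
  ((integrable_exp_neg_mul_abs (half_pos hd)).const_mul _).mono'
    (measurable_cellIntegrand hA a b).aestronglyMeasurable
    (ae_ne_zero.mono fun _ hl => norm_cellIntegrand_le hd hA hsep hl a b)

theorem hasSum_geo {κ d : ℝ} (hκ : 0 < κ) (hd : 0 < d) (p : ℕ) :
    HasSum (fun k : ℕ => Real.exp (-(κ * ((p + k) * d)))) (geo p κ d) := by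
  have h := (hasSum_geometric_of_lt_one (Real.exp_nonneg (-(κ * d)))
    (Real.exp_lt_one_iff.2 (by nlinarith))).mul_left (Real.exp (-(p * κ * d)))
  rw [← div_eq_mul_inv] at h
  refine h.congr_fun fun k => ?_
  rw [← Real.exp_nat_mul, ← Real.exp_add]
  ring_nf

/-- Dominated convergence for series: `q.1` counts the cells beyond column -p and `q.2` is the row.
-/
theorem hasSum_waveIntegral (hd : 0 < d) (hA : IsSymbol κ A)
    (hsep : Separated d ξ J p t s) (a b : Fin 2) :
    HasSum (fun q : ℕ × J => 1 / (4 * Real.pi * β ^ 2) * waveIntegral κ (fun l => A l a b)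
        (t.1 - s.1 - (q.2 : ℤ) * ξ + (p + q.1) * d) (t.2 - s.2 - (q.2 : ℤ) * η))
      (∫ l, cellIntegrand β d ξ η J p κ A t s l a b) := by
  simp only [waveIntegral, ← integral_const_mul]
  have hcard : HasSum (fun _ : J => (1 : ℝ)) J.card := by
    simpa using hasSum_fintype (fun _ : J => (1 : ℝ))
  -- By separation the horizontal distance is at least (1+k)d whatever `p` is, so the majorants form
  -- a geometric series starting at exponent 1. It diverges for κ = 0, hence the exclusion of the
  -- null set λ = 0.
  have hbound : ∀ l : ℝ, l ≠ 0 → HasSum (fun q : ℕ × J =>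
      1 / (4 * Real.pi * β ^ 2) * (κ l * (Real.exp (-(κ l * ((1 + q.1) * d))) * 1)))
      (1 / (4 * Real.pi * β ^ 2) * (κ l * (geo 1 (κ l) d * J.card))) := fun l hl => by
    have hg := hasSum_geo (hA.rate.pos hl) hd 1
    simp only [Nat.cast_one] at hg
    exact ((hasSum_mul_prod hg hcard).mul_left _).mul_left _
  refine hasSum_integral_of_dominated_convergence
    (fun q l => 1 / (4 * Real.pi * β ^ 2) * (κ l * (Real.exp (-(κ l * ((1 + q.1) * d))) * 1)))
    (fun q => (aestronglyMeasurable_mul_wave hA.rate (hA.cont a b).aestronglyMeasurable _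
      _).const_mul _) (fun q => Eventually.of_forall fun l => ?_)
    (ae_ne_zero.mono fun l hl => (hbound l hl).summable) ?_ (ae_ne_zero.mono fun l hl => ?_)
  · have h0 := hA.rate.nonneg l
    rw [norm_mul, norm_mul, norm_wave, norm_prefactor, mul_one]
    gcongr
    · exact hA.norm_le l a b
    · linarith [hsep q.2 q.2.2]
  · refine Integrable.congr (f := fun l =>
      1 / (4 * Real.pi * β ^ 2) * (κ l * (geo 1 (κ l) d * J.card))) ?_
      (ae_ne_zero.mono fun l hl => (hbound l hl).tsum_eq.symm)
    have hκ := hA.rate.cont.measurable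
    refine ((integrable_exp_neg_mul_abs (half_pos hd)).const_mul
      (1 / (4 * Real.pi * β ^ 2) * (1 / d * J.card))).mono'
      (by unfold geo; exact Measurable.aestronglyMeasurable (by fun_prop))
      (ae_ne_zero.mono fun l hl => ?_)
    have h0 := hA.rate.pos hl
    have hlt : Real.exp (-(κ l * d)) < 1 := Real.exp_lt_one_iff.2 (by nlinarith)
    have hg0 : 0 ≤ geo 1 (κ l) d := div_nonneg (Real.exp_nonneg _) (by linarith)
    rw [Real.norm_of_nonneg (by positivity)]
    calc _ = 1 / (4 * Real.pi * β ^ 2) * (κ l * (Real.exp (-(κ l * d))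
          / (1 - Real.exp (-(κ l * d)))) * J.card) := by
          simp only [geo, Nat.cast_one, one_mul]; ring
      _ ≤ 1 / (4 * Real.pi * β ^ 2) * (1 / d * Real.exp (-(d / 2 * |l|)) * J.card) := by
          have := mul_exp_div_le_abs hA.rate hd hl
          exact mul_le_mul_of_nonneg_left (mul_le_mul_of_nonneg_right this (Nat.cast_nonneg _))
            (by positivity)
      _ = _ := by ring
  · have hg : HasSum (fun k : ℕ => (Real.exp (-(κ l * ((p + k) * d))) : ℂ)) (geo p (κ l) d : ℂ) :=
      Complex.hasSum_ofReal.2 (hasSum_geo (hA.rate.pos hl) hd p)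
    have hw : HasSum (fun n : J => wave (κ l) l (t.1 - s.1 - (n : ℤ) * ξ) (t.2 - s.2 - (n : ℤ) * η))
        (∑ n ∈ J, wave (κ l) l (t.1 - s.1 - n * ξ) (t.2 - s.2 - n * η)) :=
      J.hasSum fun n : ℤ => wave (κ l) l (t.1 - s.1 - n * ξ) (t.2 - s.2 - n * η)
    have h := ((hasSum_mul_prod hg hw).mul_left (1 / (4 * Real.pi * β ^ 2) : ℂ)).mul_right (A l a b)
    have hval : cellIntegrand β d ξ η J p κ A t s l a b = 1 / (4 * Real.pi * β ^ 2)
        * (geo p (κ l) d * ∑ n ∈ J, wave (κ l) l (t.1 - s.1 - n * ξ) (t.2 - s.2 - n * η))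
        * A l a b := by
      rw [cellIntegrand, Matrix.smul_apply, smul_eq_mul]
      ring
    rw [hval]
    refine h.congr_fun fun q => ?_
    -- The column shift is purely horizontal, so it splits off as a real exponential and the double
    -- series becomes a product.
    have := wave_add (κ l) l (t.1 - s.1 - (q.2 : ℤ) * ξ) (t.2 - s.2 - (q.2 : ℤ) * η)
      ((p + q.1) * d) 0
    rw [add_zero, wave_zero_right] at this
    rw [this]
    ring

/-- The cells of `westCells J p`, listed by row and distance. -/
def westCellsEquiv (J : Finset ℤ) (p : ℕ) : ℕ × J ≃ westCells J p where
  toFun q := ⟨(-(p + q.1), q.2), by simp [westCells]⟩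
  invFun q := ((-q.1.1 - p).toNat, ⟨q.1.2, q.2.2⟩)
  left_inv q := by ext <;> simp
  right_inv q := by
    have := q.2.1
    ext
    · simp only
      omega
    · rfl

/-- Reflection of the east cells to the west cells. -/
def eastCellsEquiv (J : Finset ℤ) (p : ℕ) (hJ : ∀ n ∈ J, -n ∈ J) :
    westCells J p ≃ eastCells J p where
  toFun q := ⟨-q.1, by have := q.2.1; simp only [Prod.fst_neg]; omega, hJ _ q.2.2⟩
  invFun q := ⟨-q.1, by have := q.2.1; simp only [Prod.fst_neg]; omega, hJ _ q.2.2⟩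
  left_inv q := by simp
  right_inv q := by simp

theorem hasSum_image_west (hβ : 0 < β) (hd : 0 < d) (hsep : Separated d ξ J p t s) :
    ∃ K : Matrix (Fin 2) (Fin 2) ℝ,
      HasSum (fun q : westCells J p => image β d ξ η t s q) K ∧
      ∀ a b, (K a b : ℂ) = (∫ l, cellIntegrand β d ξ η J p (chi β) (symbB β) t s l a b)
        + ∫ l, cellIntegrand β d ξ η J p abs symbZ t s l a b := by
  have h : ∀ a b, HasSum (fun q : ℕ × J =>
      (image β d ξ η t s (westCellsEquiv J p q : ℤ × ℤ) a b : ℂ))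
      ((∫ l, cellIntegrand β d ξ η J p (chi β) (symbB β) t s l a b)
        + ∫ l, cellIntegrand β d ξ η J p abs symbZ t s l a b) := fun a b => by
    have h1 := (hasSum_waveIntegral (β := β) (η := η) hd (isSymbol_symbB hβ) hsep a b).add
      (hasSum_waveIntegral (β := β) (η := η) hd isSymbol_symbZ hsep a b)
    refine h1.congr_fun fun q => ?_
    have hx : 0 < t.1 - s.1 - (q.2 : ℤ) * ξ + (p + q.1) * d := by
      have := hsep q.2 q.2.2
      have : 0 ≤ (q.1 : ℝ) * d := by positivity
      linarith
    have harg : t - (s + latticeVec d ξ η (westCellsEquiv J p q : ℤ × ℤ))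
        = (t.1 - s.1 - (q.2 : ℤ) * ξ + (p + q.1) * d, t.2 - s.2 - (q.2 : ℤ) * η) := by
      ext <;> simp [latticeVec, westCellsEquiv] <;> ring
    rw [image, harg, stokeslet_eq_waveIntegral hβ hx, mul_add]
  refine ⟨Matrix.of fun a b => ((∫ l, cellIntegrand β d ξ η J p (chi β) (symbB β) t s l a b)
        + ∫ l, cellIntegrand β d ξ η J p abs symbZ t s l a b).re, ?_, fun a b => ?_⟩
  · rw [← (westCellsEquiv J p).hasSum_iff]
    exact Pi.hasSum.2 fun a => Pi.hasSum.2 fun b => Complex.hasSum_re (h a b)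
  · have h1 := Complex.hasSum_ofReal.2 (Complex.hasSum_re (h a b))
    exact h1.unique (h a b)

/-! ### Parity -/

theorem dX_neg {f : ℝ × ℝ → ℝ} {ε : ℝ} (hf : ∀ t, f (-t) = ε * f t) (t : ℝ × ℝ) :
    dX f (-t) = -ε * dX f t := by
  have h : (fun u => f (u, -t.2)) = fun u => ε * f (-u, t.2) := by
    ext u
    rw [← hf]
    simp
  rw [dX, dX, Prod.snd_neg, Prod.fst_neg, h, deriv_const_mul_field, deriv_comp_neg
    (f := fun u => f (u, t.2))]
  simp

theorem dY_neg {f : ℝ × ℝ → ℝ} {ε : ℝ} (hf : ∀ t, f (-t) = ε * f t) (t : ℝ × ℝ) :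
    dY f (-t) = -ε * dY f t := by
  have h : (fun u => f (-t.1, u)) = fun u => ε * f (t.1, -u) := by
    ext u
    rw [← hf]
    simp
  rw [dY, dY, Prod.snd_neg, Prod.fst_neg, h, deriv_const_mul_field, deriv_comp_neg
    (f := fun u => f (t.1, u))]
  simp

/-- The Green's function is even, and each partial derivative flips the parity. -/
theorem stokeslet_neg (β : ℝ) (t : ℝ × ℝ) : stokeslet β (-t) = stokeslet β t := by
  have h0 : ∀ t, greenMB β (-t) = 1 * greenMB β t := fun t => by simp [greenMB, len]
  have hX : ∀ t, dX (greenMB β) (-t) = -1 * dX (greenMB β) t := dX_neg h0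
  have hY : ∀ t, dY (greenMB β) (-t) = -1 * dY (greenMB β) t := dY_neg h0
  simp [stokeslet, dX_neg hX, dX_neg hY, dY_neg hY]

theorem image_neg (β d ξ η : ℝ) (t s : ℝ × ℝ) (q : ℤ × ℤ) :
    image β d ξ η t s (-q) = image β d ξ η s t q := by
  rw [image, image, ← stokeslet_neg]
  congr 1
  ext <;> simp [latticeVec] <;> ring

/-- Evenness exchanges target and source while negating the cell index, so the east sum at (t,s) is
the west sum at (s,t). -/
theorem hasSum_image_east (hJ : ∀ n ∈ J, -n ∈ J) {K : Matrix (Fin 2) (Fin 2) ℝ}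
    (h : HasSum (fun q : westCells J p => image β d ξ η s t q) K) :
    HasSum (fun q : eastCells J p => image β d ξ η t s q) K := by
  rw [← (eastCellsEquiv J p hJ).hasSum_iff]
  exact h.congr_fun fun q => image_neg β d ξ η t s q

end

/-! ### Uniform quadrature for compact families -/

theorem exists_isCompact_setIntegral_compl_lt {g : ℝ → ℝ} (hg : Integrable g) {ε : ℝ}
    (hε : 0 < ε) : ∃ S : Set ℝ, IsCompact S ∧ (0 : ℝ) ∉ S ∧ ∫ l in Sᶜ, g l < ε := by
  -- Annuli exhausting the punctured line: their complements shrink to the null set {0}, so the tail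
  -- integrals tend to 0.
  let S : ℕ → Set ℝ := fun k => {l | 1 / ((k : ℝ) + 1) ≤ |l| ∧ |l| ≤ k + 1}
  have hclosed : ∀ k, IsClosed (S k) := fun k =>
    (isClosed_le continuous_const continuous_abs).inter
      (isClosed_le continuous_abs continuous_const)
  have hanti : Antitone fun k => (S k)ᶜ := fun i j hij => by
    refine compl_subset_compl.2 fun l hl => ?_
    have hij' : (i : ℝ) ≤ j := Nat.cast_le.2 hij
    exact ⟨(one_div_le_one_div_of_le (by positivity) (by linarith)).trans hl.1,
      hl.2.trans (by linarith)⟩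
  have hinter : ⋂ k, (S k)ᶜ = {0} := by
    ext l
    simp only [mem_iInter, mem_compl_iff, mem_singleton_iff]
    constructor
    · intro h
      by_contra hl
      obtain ⟨k, hk⟩ := exists_nat_gt (max |l| (1 / |l|))
      have hl' : 0 < |l| := abs_pos.2 hl
      refine h k ⟨?_, ((le_max_left _ _).trans hk.le).trans (by linarith)⟩
      rw [one_div_le (by positivity) hl']
      exact ((le_max_right _ _).trans hk.le).trans (by linarith)
    · rintro rfl k ⟨h, -⟩
      rw [abs_zero] at h
      exact absurd h (not_le.2 (by positivity))
  have htends := tendsto_setIntegral_of_antitone (fun k => (hclosed k).measurableSet.compl) hanti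
    ⟨0, hg.integrableOn⟩
  rw [hinter, setIntegral_measure_zero _ (measure_singleton 0)] at htends
  obtain ⟨k, hk⟩ := (htends.eventually_lt_const hε).exists
  refine ⟨S k, Metric.isCompact_of_isClosed_isBounded (hclosed k) ?_, fun h => ?_, hk⟩
  · refine (Metric.isBounded_Icc (-((k : ℝ) + 1)) (k + 1)).subset fun l hl => ?_
    exact abs_le.1 hl.2
  · have h1 := h.1
    rw [abs_zero] at h1
    exact absurd h1 (not_le.2 (by positivity))

theorem exists_uniform_modulus {ι Z : Type*} [Finite ι] [PseudoMetricSpace Z] {K : Set Z}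
    (hK : IsCompact K) {S : Set ℝ} (hS : IsCompact S) {f : ι → Z → ℝ → ℂ}
    (hf : ∀ i, ContinuousOn (fun q : Z × ℝ => f i q.1 q.2) (K ×ˢ S)) {ε : ℝ} (hε : 0 < ε) :
    ∃ h > 0, ∀ i, ∀ z ∈ K, ∀ l ∈ S, ∀ l' ∈ S, |l - l'| < h → ‖f i z l - f i z l'‖ ≤ ε := by
  have h1 : ∀ i, ∀ᶠ h in 𝓝[>] (0 : ℝ),
      ∀ z ∈ K, ∀ l ∈ S, ∀ l' ∈ S, |l - l'| < h → ‖f i z l - f i z l'‖ ≤ ε := fun i => by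
    obtain ⟨δ, hδ, H⟩ := Metric.uniformContinuousOn_iff.1
      ((hK.prod hS).uniformContinuousOn_of_continuous (hf i)) ε hε
    filter_upwards [Ioo_mem_nhdsGT hδ] with h hh z hz l hl l' hl' hll
    have := H (z, l) ⟨hz, hl⟩ (z, l') ⟨hz, hl'⟩
      (by rw [Prod.dist_eq]; simpa [Real.dist_eq, hδ] using hll.trans hh.2)
    rw [dist_eq_norm] at this
    exact this.le
  obtain ⟨h, h2, h3⟩ := ((eventually_all.2 h1).and self_mem_nhdsWithin).exists
  exact ⟨h, h3, h2⟩

/-- Half of ε is spent on the part outside a compact set `S` avoiding 0, through the majorant. The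
other half is spent on a Riemann sum over `S`, with a mesh given by uniform continuity on `K ×ˢ S`,
so the rule does not depend on the parameter. -/
theorem exists_rule_of_dominated {ι Z : Type*} [Finite ι] [PseudoMetricSpace Z] {K : Set Z}
    (hK : IsCompact K) {f : ι → Z → ℝ → ℂ} {g : ℝ → ℝ} (hg : Integrable g)
    (hint : ∀ i, ∀ z ∈ K, Integrable (f i z))
    (hbd : ∀ i, ∀ z ∈ K, ∀ l ≠ 0, ‖f i z l‖ ≤ g l)
    (hf : ∀ i, ContinuousOn (fun q : Z × ℝ => f i q.1 q.2) (K ×ˢ {0}ᶜ)) {ε : ℝ} (hε : 0 < ε) :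
    ∃ Q : Rule, (∀ n, Q.node n ≠ 0) ∧ ∀ i, ∀ z ∈ K,
      ‖(∫ l, f i z l) - ∑ n, (Q.weight n : ℂ) * f i z (Q.node n)‖ ≤ ε := by
  obtain ⟨S, hS, hS0, htail⟩ := exists_isCompact_setIntegral_compl_lt hg (half_pos hε)
  have hSm := hS.measurableSet
  have hSfin : volume S ≠ ⊤ := hS.measure_lt_top.ne
  let V := volume.real S
  have hV : 0 ≤ V := measureReal_nonneg
  obtain ⟨h, hh, hmod⟩ := exists_uniform_modulus hK hS
    (fun i => (hf i).mono (prod_mono_right fun l hl => by rintro rfl; exact hS0 hl))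
    -- Adding 1 to the volume avoids division by zero when `S` is null.
    (show 0 < ε / 2 / (V + 1) by positivity)
  let P : ℤ → Set ℝ := fun j => S ∩ {l | ⌊l / h⌋ = j}
  have hPm : ∀ j, MeasurableSet (P j) := fun j =>
    hSm.inter (measurableSet_eq_fun (by fun_prop) measurable_const)
  have hPS : ∀ j, P j ⊆ S := fun j => inter_subset_left
  have hPdisj : Pairwise (Function.onFun Disjoint P) := fun i j hij =>
    disjoint_left.2 fun l h1 h2 => hij (h1.2.symm.trans h2.2)
  have hPclose : ∀ j, ∀ l ∈ P j, ∀ l' ∈ P j, |l - l'| < h := fun j l hl l' hl' => by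
    have := Int.abs_sub_lt_one_of_floor_eq_floor (hl.2.trans hl'.2.symm)
    rwa [← sub_div, abs_div, abs_of_pos hh, div_lt_one hh] at this
  -- An empty piece has weight 0, so any nonzero node will do.
  have hnode : ∀ j, ∃ x : ℝ, x ≠ 0 ∧ ∀ l ∈ P j, x ∈ P j := fun j => by
    rcases (P j).eq_empty_or_nonempty with he | ⟨x, hx⟩
    · exact ⟨1, one_ne_zero, fun l hl => absurd hl (by simp [he])⟩
    · exact ⟨x, fun h0 => hS0 (h0 ▸ hx.1), fun _ _ => hx⟩
  choose x hx0 hxP using hnode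
  obtain ⟨M, hM⟩ := hS.isBounded.exists_norm_le
  let I : Finset ℤ := Finset.Icc ⌊-M / h⌋ ⌊M / h⌋
  have hcover : S = ⋃ j ∈ I, P j := by
    ext l
    simp only [mem_iUnion]
    constructor
    · intro hl
      have := abs_le.1 (hM l hl)
      refine ⟨⌊l / h⌋, Finset.mem_Icc.2 ⟨Int.floor_mono ?_, Int.floor_mono ?_⟩, hl, rfl⟩
      · exact div_le_div_of_nonneg_right this.1 hh.le
      · exact div_le_div_of_nonneg_right this.2 hh.le
    · rintro ⟨j, -, hl⟩
      exact hPS j hl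
  refine ⟨⟨I.card, fun n => x (I.equivFin.symm n), fun n => volume.real (P (I.equivFin.symm n))⟩,
    fun n => hx0 _, fun i z hz => ?_⟩
  have hsum : ∑ n, ((volume.real (P (I.equivFin.symm n)) : ℝ) : ℂ) * f i z (x (I.equivFin.symm n))
      = ∑ j ∈ I, (volume.real (P j) : ℂ) * f i z (x j) := by
    rw [I.equivFin.symm.sum_comp (fun j : I => (volume.real (P j) : ℂ) * f i z (x j)),
      Finset.sum_coe_sort I (fun j => (volume.real (P j) : ℂ) * f i z (x j))]
  have hfi := hint i z hz
  have hsplit : ∫ l in S, f i z l = ∑ j ∈ I, ∫ l in P j, f i z l := by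
    conv_lhs => rw [hcover]
    exact integral_biUnion_finset I (fun j _ => hPm j) (fun a _ b _ hab => hPdisj hab)
      fun j _ => hfi.integrableOn
  have hvol : V = ∑ j ∈ I, volume.real (P j) := by
    simp only [V]
    conv_lhs => rw [hcover]
    exact measureReal_biUnion_finset (fun a _ b _ hab => hPdisj hab) (fun j _ => hPm j)
      fun j _ => measure_ne_top_of_subset (hPS j) hSfin
  have hpiece : ∀ j ∈ I, ‖(∫ l in P j, f i z l) - (volume.real (P j) : ℂ) * f i z (x j)‖
      ≤ ε / 2 / (V + 1) * volume.real (P j) := fun j _ => by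
    have hfin : volume (P j) < ⊤ := (measure_ne_top_of_subset (hPS j) hSfin).lt_top
    have h1 : (volume.real (P j) : ℂ) * f i z (x j) = ∫ _ in P j, f i z (x j) := by
      rw [setIntegral_const, Complex.real_smul]
    rw [h1, ← integral_sub hfi.integrableOn (integrableOn_const hfin.ne)]
    refine norm_setIntegral_le_of_norm_le_const hfin fun l hl => ?_
    exact hmod i z hz l hl.1 _ (hxP j l hl).1 (hPclose j l hl _ (hxP j l hl))
  have htail' : ‖∫ l in Sᶜ, f i z l‖ ≤ ε / 2 := by
    refine (norm_integral_le_of_norm_le hg.integrableOn ?_).trans htail.le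
    exact ae_restrict_of_ae (ae_ne_zero.mono fun l hl => hbd i z hz l hl)
  rw [hsum, ← integral_add_compl hSm hfi, hsplit, add_sub_right_comm, ← Finset.sum_sub_distrib]
  refine (norm_add_le _ _).trans ?_
  have h2 : ‖∑ j ∈ I, ((∫ l in P j, f i z l) - (volume.real (P j) : ℂ) * f i z (x j))‖ ≤ ε / 2 := by
    refine (norm_sum_le_of_le I hpiece).trans ?_
    rw [← Finset.mul_sum, ← hvol, div_mul_eq_mul_div, div_le_iff₀ (by positivity)]
    nlinarith
  linarith

/-! ### Quadrature rules for the cells -/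

section

variable {β d ξ η : ℝ} {J : Finset ℤ} {p : ℕ} {κ : ℝ → ℝ} {A : ℝ → Matrix (Fin 2) (Fin 2) ℂ}
  {t s : ℝ × ℝ}

theorem cellIntegrand_sub (t s : ℝ × ℝ) :
    cellIntegrand β d ξ η J p κ A t s = cellIntegrand β d ξ η J p κ A (t - s) 0 := by
  ext l
  simp [cellIntegrand]

theorem sub_mem_cell (ht : t ∈ cell d ξ η) (hs : s ∈ cell d ξ η) :
    ∃ a ∈ Icc (-1 : ℝ) 1, ∃ b ∈ Icc (-1 : ℝ) 1, t - s = (a * d + b * ξ, b * η) := by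
  obtain ⟨a, ha, b, hb, rfl⟩ := ht
  obtain ⟨a', ha', b', hb', rfl⟩ := hs
  refine ⟨a - a', ⟨by linarith [ha.1, ha'.2], by linarith [ha.2, ha'.1]⟩, b - b',
    ⟨by linarith [hb.1, hb'.2], by linarith [hb.2, hb'.1]⟩, ?_⟩
  ext <;> simp <;> ring

theorem continuousOn_cellIntegrand (hd : 0 < d) (hA : IsSymbol κ A) (i j : Fin 2) :
    ContinuousOn (fun q : (ℝ × ℝ × ℝ) × ℝ => cellIntegrand β d q.1.2.2 η J p κ A
      (q.1.1 * d + q.1.2.1 * q.1.2.2, q.1.2.1 * η) 0 q.2 i j) (univ ×ˢ {0}ᶜ) := by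
  have hκ : Continuous fun q : (ℝ × ℝ × ℝ) × ℝ => κ q.2 := hA.rate.cont.comp continuous_snd
  have hw : Continuous fun q : (ℝ × ℝ × ℝ) × ℝ => ∑ n ∈ J, wave (κ q.2) q.2
      (q.1.1 * d + q.1.2.1 * q.1.2.2 - (0 : ℝ × ℝ).1 - n * q.1.2.2)
      (q.1.2.1 * η - (0 : ℝ × ℝ).2 - n * η) :=
    continuous_finsetSum J fun n _ =>
      continuous_wave hκ continuous_snd (by fun_prop) (by fun_prop)
  have hg : ContinuousOn (fun q : (ℝ × ℝ × ℝ) × ℝ => (geo p (κ q.2) d : ℂ)) (univ ×ˢ {0}ᶜ) := by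
    refine Complex.continuous_ofReal.comp_continuousOn (ContinuousOn.div ?_ ?_ fun q hq => ?_)
    · exact (Real.continuous_exp.comp
        ((continuous_const.mul hκ).mul continuous_const).neg).continuousOn
    · exact (continuous_const.sub (Real.continuous_exp.comp
        (hκ.mul continuous_const).neg)).continuousOn
    · have h0 : 0 < κ q.2 := hA.rate.pos hq.2
      have : Real.exp (-(κ q.2 * d)) < 1 := Real.exp_lt_one_iff.2 (by nlinarith)
      linarith
  exact ((continuous_const.mul hw).continuousOn.mul hg).mul
    ((hA.cont i j).comp continuous_snd).continuousOn

/-- The integrand depends on `t - s` only, which is given by (a,b) in [-1,1]². Taking ξ in [-X,X] as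
a third compact parameter yields one rule for all lattices at once. -/
theorem exists_rule_cell (hd : 0 < d) (hA : IsSymbol κ A) {X : ℝ}
    (hsep : ∀ ξ ∈ Icc (-X) X, ∀ a ∈ Icc (-1 : ℝ) 1, ∀ b ∈ Icc (-1 : ℝ) 1,
      Separated d ξ J p (a * d + b * ξ, b * η) 0) {ε : ℝ} (hε : 0 < ε) :
    ∃ Q : Rule, (∀ n, Q.node n ≠ 0) ∧ ∀ ξ ∈ Icc (-X) X,
      Q.Precise ε (cell d ξ η) (cellIntegrand β d ξ η J p κ A) := by
  obtain ⟨Q, hQ0, hQ⟩ := exists_rule_of_dominated (ι := Fin 2 × Fin 2)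
    (K := Icc (-1 : ℝ) 1 ×ˢ (Icc (-1 : ℝ) 1 ×ˢ Icc (-X) X))
    (isCompact_Icc.prod (isCompact_Icc.prod isCompact_Icc))
    (f := fun i z l => cellIntegrand β d z.2.2 η J p κ A
      (z.1 * d + z.2.1 * z.2.2, z.2.1 * η) 0 l i.1 i.2)
    ((integrable_exp_neg_mul_abs (half_pos hd)).const_mul
      (1 / (4 * Real.pi * β ^ 2) * (J.card * (1 / d))))
    (fun i z hz => integrable_cellIntegrand hd hA (hsep _ hz.2.2 _ hz.1 _ hz.2.1) i.1 i.2)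
    (fun i z hz l hl =>
      norm_cellIntegrand_le hd hA (hsep _ hz.2.2 _ hz.1 _ hz.2.1) hl i.1 i.2)
    (fun i => (continuousOn_cellIntegrand hd hA i.1 i.2).mono (prod_mono_left (subset_univ _))) hε
  refine ⟨Q, hQ0, fun ξ hξ t ht s hs i j => ?_⟩
  obtain ⟨a, ha, b, hb, hts⟩ := sub_mem_cell ht hs
  rw [cellIntegrand_sub, hts, ← Complex.sub_re]
  exact (Complex.abs_re_le_norm _).trans (hQ (i, j) (a, b, ξ) ⟨ha, hb, hξ⟩)

/-! ### The factorization -/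

/-- Block diagonal factor for the image cells with `m ≤ -p` and `n ∈ J`. -/
def cellDiag (β d ξ η : ℝ) (J : Finset ℤ) (p : ℕ) (κ : ℝ → ℝ)
    (A : ℝ → Matrix (Fin 2) (Fin 2) ℂ) (Q : Rule) :
    Matrix (Fin Q.N × Fin 2) (Fin Q.N × Fin 2) ℂ :=
  Matrix.comp _ _ _ _ _ (Matrix.diagonal fun n =>
    ((Q.weight n : ℂ) / (4 * Real.pi * β ^ 2)
      * (∑ m ∈ J, wave (κ (Q.node n)) (Q.node n) (-(m * ξ)) (-(m * η)))
      * (geo p (κ (Q.node n)) d : ℂ)) • A (Q.node n))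

variable {NT NS : ℕ}

/-- The outer blocks are scalar multiples of the identity and the middle factor is block diagonal,
so only the sum over nodes survives. -/
theorem factor_apply (κ : ℝ → ℝ) (Q : Rule) (T : Fin NT → ℝ × ℝ) (S : Fin NS → ℝ × ℝ)
    (D : Fin Q.N → Matrix (Fin 2) (Fin 2) ℂ) (l : Fin NT) (j : Fin NS) (a b : Fin 2) :
    (leftFactor κ Q T * Matrix.comp _ _ _ _ _ (Matrix.diagonal D) * rightFactor κ Q S) (l, a) (j, b)
      = ∑ n, wave (κ (Q.node n)) (Q.node n) (T l).1 (T l).2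
        * wave (κ (Q.node n)) (Q.node n) (-(S j).1) (-(S j).2) * D n a b := by
  have h1 : ∀ n c, (leftFactor κ Q T * Matrix.comp _ _ _ _ _ (Matrix.diagonal D)) (l, a) (n, c)
      = wave (κ (Q.node n)) (Q.node n) (T l).1 (T l).2 * D n a c := fun n c => by
    rw [Matrix.mul_apply, Fintype.sum_prod_type, Finset.sum_eq_single n, Finset.sum_eq_single a]
    · simp [leftFactor, Matrix.comp_apply]
    · intro c' _ hc
      simp [leftFactor, Matrix.comp_apply, Matrix.one_apply_ne hc.symm]
    · simp
    · intro m _ hm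
      simp [Matrix.comp_apply, Matrix.diagonal_apply_ne _ hm]
    · simp
  rw [Matrix.mul_apply, Fintype.sum_prod_type]
  refine Finset.sum_congr rfl fun n _ => ?_
  rw [Finset.sum_eq_single b]
  · rw [h1]
    simp only [rightFactor, Matrix.comp_apply, Matrix.of_apply, Matrix.smul_apply,
      Matrix.one_apply_eq, smul_eq_mul]
    ring
  · intro c _ hc
    simp [rightFactor, Matrix.comp_apply, Matrix.one_apply_ne hc]
  · simp

theorem west_factor_apply (Q : Rule) (T : Fin NT → ℝ × ℝ) (S : Fin NS → ℝ × ℝ)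
    (l : Fin NT) (j : Fin NS) (a b : Fin 2) :
    (leftFactor κ Q T * cellDiag β d ξ η J p κ A Q * rightFactor κ Q S) (l, a) (j, b)
      = ∑ n, (Q.weight n : ℂ) * cellIntegrand β d ξ η J p κ A (T l) (S j) (Q.node n) a b := by
  rw [cellDiag, factor_apply]
  refine Finset.sum_congr rfl fun n _ => ?_
  have h : ∀ m : ℤ, wave (κ (Q.node n)) (Q.node n) ((T l).1 - (S j).1 - m * ξ)
      ((T l).2 - (S j).2 - m * η)
      = wave (κ (Q.node n)) (Q.node n) (T l).1 (T l).2
        * wave (κ (Q.node n)) (Q.node n) (-(S j).1) (-(S j).2)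
        * wave (κ (Q.node n)) (Q.node n) (-(m * ξ)) (-(m * η)) := fun m => by
    rw [← wave_add, ← wave_add]
    rfl
  simp only [cellIntegrand, h, ← Finset.mul_sum, Matrix.smul_apply, smul_eq_mul]
  ring

/-- Conjugating a wave changes the sign of `y` only. Reflecting `x` therefore turns each outer
factor into the conjugate of the opposite one with targets and sources exchanged. -/
theorem east_factor_apply (Q : Rule) (T : Fin NT → ℝ × ℝ) (S : Fin NS → ℝ × ℝ)
    (l : Fin NT) (j : Fin NS) (a b : Fin 2) :
    (leftFactor κ Q (reflect T) * conjM (cellDiag β d ξ η J p κ A Q)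
        * rightFactor κ Q (reflect S)) (l, a) (j, b)
      = conj (∑ n, (Q.weight n : ℂ)
        * cellIntegrand β d ξ η J p κ A (S j) (T l) (Q.node n) a b) := by
  have hD : ∀ D : Fin Q.N → Matrix (Fin 2) (Fin 2) ℂ,
      conjM (Matrix.comp _ _ _ _ _ (Matrix.diagonal D))
        = Matrix.comp _ _ _ _ _ (Matrix.diagonal fun n => conjM (D n)) := fun D => by
    ext ⟨n, a⟩ ⟨m, b⟩
    by_cases h : n = m
    · subst h
      simp [conjM, Matrix.comp_apply]
    · simp [conjM, Matrix.comp_apply, Matrix.diagonal_apply_ne _ h]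
  rw [← west_factor_apply Q S T j l a b, cellDiag, hD, factor_apply, factor_apply, map_sum]
  refine Finset.sum_congr rfl fun n _ => ?_
  rw [map_mul, map_mul, conj_wave, conj_wave]
  simp only [reflect, neg_neg, conjM, Matrix.map_apply]
  ring

/-- For real strengths, taking real parts commutes with the matrix-vector product. -/
theorem realPartApprox_of_entries {P : Matrix (Fin NT × Fin 2) (Fin NS × Fin 2) ℝ}
    {F : Matrix (Fin NT × Fin 2) (Fin NS × Fin 2) ℂ} {ε : ℝ}
    (h : ∀ i j, |P i j - (F i j).re| ≤ ε) : RealPartApprox P F ε := by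
  refine ⟨h, fun q i => ?_⟩
  have h1 : P.mulVec q i - (F.mulVec (fun j => (q j : ℂ)) i).re
      = ∑ j, (P i j - (F i j).re) * q j := by
    simp only [Matrix.mulVec, dotProduct, Complex.re_sum, Complex.re_mul_ofReal,
      ← Finset.sum_sub_distrib, sub_mul]
  rw [h1, Finset.mul_sum]
  refine (Finset.abs_sum_le_sum_abs _ _).trans (Finset.sum_le_sum fun j _ => ?_)
  rw [abs_mul]
  exact mul_le_mul_of_nonneg_right (h i j) (abs_nonneg _)

/-! ### Plane-wave expansion of the kernels -/

theorem kernel_expansion (hβ : 0 < β) (hd : 0 < d) (hJ : ∀ n ∈ J, -n ∈ J)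
    (hts : Separated d ξ J p t s) (hst : Separated d ξ J p s t) :
    Summable (fun q : westCells J p => image β d ξ η t s q) ∧
    Summable (fun q : eastCells J p => image β d ξ η t s q) ∧
    ∀ a b : Fin 2,
      Integrable (fun l => cellIntegrand β d ξ η J p (chi β) (symbB β) t s l a b) ∧
      Integrable (fun l => cellIntegrand β d ξ η J p abs symbZ t s l a b) ∧
      ((kernel (westCells J p) β d ξ η t s a b : ℝ) : ℂ) =
        (∫ l, cellIntegrand β d ξ η J p (chi β) (symbB β) t s l a b)
          + ∫ l, cellIntegrand β d ξ η J p abs symbZ t s l a b := by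
  obtain ⟨K, hK, hKe⟩ := hasSum_image_west (η := η) hβ hd hts
  obtain ⟨K', hK', -⟩ := hasSum_image_west (η := η) hβ hd hst
  refine ⟨hK.summable, (hasSum_image_east hJ hK').summable, fun a b =>
    ⟨integrable_cellIntegrand hd (isSymbol_symbB hβ) hts a b,
      integrable_cellIntegrand hd isSymbol_symbZ hts a b, ?_⟩⟩
  rw [← hKe, kernel, hK.tsum_eq]

theorem kernel_east (hβ : 0 < β) (hd : 0 < d) (hJ : ∀ n ∈ J, -n ∈ J)
    (hst : Separated d ξ J p s t) :
    kernel (eastCells J p) β d ξ η t s = kernel (westCells J p) β d ξ η s t := by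
  obtain ⟨K, hK, -⟩ := hasSum_image_west (η := η) hβ hd hst
  rw [kernel, kernel, hK.tsum_eq, (hasSum_image_east hJ hK).tsum_eq]

theorem abs_kernel_sub_le {ε : ℝ} {QB QZ : Rule} (hβ : 0 < β) (hd : 0 < d)
    (hJ : ∀ n ∈ J, -n ∈ J)
    (hsep : ∀ t ∈ cell d ξ η, ∀ s ∈ cell d ξ η, Separated d ξ J p t s)
    (hQB : QB.Precise ε (cell d ξ η) (cellIntegrand β d ξ η J p (chi β) (symbB β)))
    (hQZ : QZ.Precise ε (cell d ξ η) (cellIntegrand β d ξ η J p abs symbZ))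
    (ht : t ∈ cell d ξ η) (hs : s ∈ cell d ξ η) (a b : Fin 2) :
    |kernel (westCells J p) β d ξ η t s a b
      - ((∑ n, (QB.weight n : ℂ)
          * cellIntegrand β d ξ η J p (chi β) (symbB β) t s (QB.node n) a b).re
        + (∑ n, (QZ.weight n : ℂ)
          * cellIntegrand β d ξ η J p abs symbZ t s (QZ.node n) a b).re)| ≤ 2 * ε := by
  have h := ((kernel_expansion (η := η) hβ hd hJ (hsep t ht s hs) (hsep s hs t ht)).2.2 a b).2.2
  have hre := congrArg Complex.re h
  rw [Complex.ofReal_re, Complex.add_re] at hre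
  rw [hre, add_sub_add_comm, two_mul]
  exact (abs_add_le _ _).trans (add_le_add (hQB t ht s hs a b) (hQZ t ht s hs a b))

theorem realPartApprox_cells {ε : ℝ} {QB QZ : Rule} (hβ : 0 < β) (hd : 0 < d)
    (hJ : ∀ n ∈ J, -n ∈ J)
    (hsep : ∀ t ∈ cell d ξ η, ∀ s ∈ cell d ξ η, Separated d ξ J p t s)
    (hQB : QB.Precise ε (cell d ξ η) (cellIntegrand β d ξ η J p (chi β) (symbB β)))
    (hQZ : QZ.Precise ε (cell d ξ η) (cellIntegrand β d ξ η J p abs symbZ))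
    {T : Fin NT → ℝ × ℝ} {S : Fin NS → ℝ × ℝ} (hT : ∀ l, T l ∈ cell d ξ η)
    (hS : ∀ j, S j ∈ cell d ξ η) :
    RealPartApprox (periodizing (westCells J p) β d ξ η T S)
      (leftFactor (chi β) QB T * cellDiag β d ξ η J p (chi β) (symbB β) QB
          * rightFactor (chi β) QB S
        + leftFactor abs QZ T * cellDiag β d ξ η J p abs symbZ QZ * rightFactor abs QZ S)
      (2 * ε) ∧
    RealPartApprox (periodizing (eastCells J p) β d ξ η T S)
      (leftFactor (chi β) QB (reflect T) * conjM (cellDiag β d ξ η J p (chi β) (symbB β) QB)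
          * rightFactor (chi β) QB (reflect S)
        + leftFactor abs QZ (reflect T) * conjM (cellDiag β d ξ η J p abs symbZ QZ)
          * rightFactor abs QZ (reflect S)) (2 * ε) := by
  constructor
  · refine realPartApprox_of_entries fun ⟨l, a⟩ ⟨j, b⟩ => ?_
    rw [Matrix.add_apply, west_factor_apply, west_factor_apply, Complex.add_re]
    exact abs_kernel_sub_le hβ hd hJ hsep hQB hQZ (hT l) (hS j) a b
  · refine realPartApprox_of_entries fun ⟨l, a⟩ ⟨j, b⟩ => ?_
    -- Conjugation leaves real parts unchanged, so the west estimate with target and source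
    -- exchanged applies with the same rules.
    rw [Matrix.add_apply, east_factor_apply, east_factor_apply, Complex.add_re, Complex.conj_re,
      Complex.conj_re]
    have hK : periodizing (eastCells J p) β d ξ η T S (l, a) (j, b)
        = kernel (westCells J p) β d ξ η (S j) (T l) a b := by
      rw [← kernel_east hβ hd hJ (hsep _ (hS j) _ (hT l))]
      rfl
    rw [hK]
    exact abs_kernel_sub_le hβ hd hJ hsep hQB hQZ (hS j) (hT l) a b

/-! ### The singly and doubly periodic cells -/

theorem separated_of_sub (h : Separated d ξ J p (t - s) 0) : Separated d ξ J p t s :=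
  fun n hn => by simpa using h n hn

theorem separated_single (hd : 0 < d) : ∀ ξ ∈ Icc (-0 : ℝ) 0, ∀ a ∈ Icc (-1 : ℝ) 1,
    ∀ b ∈ Icc (-1 : ℝ) 1, Separated d ξ {0} 2 (a * d + b * ξ, b * η) 0 := by
  intro ξ hξ a ha b _ n hn
  have h0 : ξ = 0 := le_antisymm hξ.2 (by simpa using hξ.1)
  have := mul_le_mul_of_nonneg_right ha.1 hd.le
  simp [h0]
  linarith

/-- The horizontal offset ad + (b-n)ξ is at least -d - 2d, so p = 4 leaves the distance d. In the
singly periodic case it is at least -d, so p = 2 suffices. -/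
theorem separated_double (hd : 0 < d) : ∀ ξ ∈ Icc (-d) d, ∀ a ∈ Icc (-1 : ℝ) 1,
    ∀ b ∈ Icc (-1 : ℝ) 1, Separated d ξ (Finset.Icc (-1) 1) 4 (a * d + b * ξ, b * η) 0 := by
  intro ξ hξ a ha b hb n hn
  have h1 := mul_le_mul_of_nonneg_right ha.1 hd.le
  obtain ⟨hn1, hn2⟩ := Finset.mem_Icc.1 hn
  have hn1' : (-1 : ℝ) ≤ n := by exact_mod_cast hn1
  have hn2' : (n : ℝ) ≤ 1 := by exact_mod_cast hn2
  have h2 : |(b - n) * ξ| ≤ 2 * d := by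
    rw [abs_mul]
    refine mul_le_mul (abs_le.2 ⟨?_, ?_⟩) (abs_le.2 hξ) (abs_nonneg _) zero_le_two
    · linarith [hb.1]
    · linarith [hb.2]
  have h3 := (abs_le.1 h2).1
  simp only [Prod.fst_zero, Nat.cast_ofNat, sub_zero]
  linarith

theorem separated_cell {X : ℝ} (hsep : ∀ ξ ∈ Icc (-X) X, ∀ a ∈ Icc (-1 : ℝ) 1,
      ∀ b ∈ Icc (-1 : ℝ) 1, Separated d ξ J p (a * d + b * ξ, b * η) 0) (hξ : ξ ∈ Icc (-X) X) :
    ∀ t ∈ cell d ξ η, ∀ s ∈ cell d ξ η, Separated d ξ J p t s := by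
  intro t ht s hs
  obtain ⟨a, ha, b, hb, h⟩ := sub_mem_cell ht hs
  exact separated_of_sub (h ▸ hsep ξ hξ a ha b hb)

end

/-! ### Identification of the two periodic cases with the general row set and offset. -/

theorem west1_eq : west1 = westCells {0} 2 := by
  ext q
  simp [west1, westCells]

theorem east1_eq : east1 = eastCells {0} 2 := by
  ext q
  simp [east1, eastCells]

theorem west2_eq : west2 = westCells (Finset.Icc (-1) 1) 4 := by
  ext q
  simp [west2, westCells]

theorem east2_eq : east2 = eastCells (Finset.Icc (-1) 1) 4 := by
  ext q
  simp [east2, eastCells]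

section

variable (β d ξ η : ℝ) (κ : ℝ → ℝ) (A : ℝ → Matrix (Fin 2) (Fin 2) ℂ)

theorem integrand1_eq : integrand1 β d κ A = cellIntegrand β d 0 η {0} 2 κ A := by
  ext t s l
  simp [integrand1, cellIntegrand]

theorem integrand2_eq :
    integrand2 β d ξ η κ A = cellIntegrand β d ξ η (Finset.Icc (-1) 1) 4 κ A := rfl

theorem diag1_eq (Q : Rule) : diag1 β d κ A Q = cellDiag β d 0 η {0} 2 κ A Q := by
  simp [diag1, cellDiag, wave]

theorem diag2_eq (Q : Rule) :
    diag2 β d ξ η κ A Q = cellDiag β d ξ η (Finset.Icc (-1) 1) 4 κ A Q := by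
  have h : ∀ k l : ℝ, bracket k l ξ η
      = ∑ m ∈ Finset.Icc (-1 : ℤ) 1, wave k l (-(m * ξ)) (-(m * η)) := fun k l => by
    have hI : Finset.Icc (-1 : ℤ) 1 = {-1, 1, 0} := by decide
    have h0 : wave k l 0 0 = 1 := by simp [wave]
    rw [hI, Finset.sum_insert (by decide), Finset.sum_insert (by decide), Finset.sum_singleton,
      bracket]
    simp [h0, add_assoc]
  simp only [diag2, cellDiag, h]

end

end PeriodicMS
end

open MeasureTheory PeriodicMS in
theorem mainTheorem7 (β d η : ℝ) (hβ : 0 < β) (hd : 0 < d) (hη : 0 < η) :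
    -- singly periodic, rectangular unit cell of dimension d × η
    ((∀ t ∈ cell d 0 η, ∀ s ∈ cell d 0 η,
        Summable (fun p : west1 => image β d 0 η t s p) ∧
        Summable (fun p : east1 => image β d 0 η t s p) ∧
        ∀ a b : Fin 2,
          Integrable (fun lam => integrand1 β d (chi β) (symbB β) t s lam a b) ∧
          Integrable (fun lam => integrand1 β d abs symbZ t s lam a b) ∧
          ((kernel west1 β d 0 η t s a b : ℝ) : ℂ) =
            (∫ lam, integrand1 β d (chi β) (symbB β) t s lam a b)
              + ∫ lam, integrand1 β d abs symbZ t s lam a b) ∧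
      (∀ ε : ℝ, 0 < ε →
        (∃ QB : Rule, QB.Precise ε (cell d 0 η) (integrand1 β d (chi β) (symbB β))) ∧
        (∃ QZ : Rule, (∀ n, QZ.node n ≠ 0) ∧
          QZ.Precise ε (cell d 0 η) (integrand1 β d abs symbZ))) ∧
      (∀ ε : ℝ, 0 < ε → ∀ QB QZ : Rule,
        QB.Precise ε (cell d 0 η) (integrand1 β d (chi β) (symbB β)) →
        (∀ n, QZ.node n ≠ 0) →
        QZ.Precise ε (cell d 0 η) (integrand1 β d abs symbZ) →
        ∀ (NT NS : ℕ) (T : Fin NT → ℝ × ℝ) (S : Fin NS → ℝ × ℝ),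
          (∀ l, T l ∈ cell d 0 η) → (∀ j, S j ∈ cell d 0 η) →
          RealPartApprox (periodizing west1 β d 0 η T S)
            (lowRankWest1 β d QB QZ T S) (2 * ε) ∧
          RealPartApprox (periodizing east1 β d 0 η T S)
            (lowRankEast1 β d QB QZ T S) (2 * ε))) ∧
    -- doubly periodic, parallelogram with ‖e₂‖ ≤ ‖e₁‖
    ((∀ ξ : ℝ, Real.sqrt (ξ ^ 2 + η ^ 2) ≤ d →
        ∀ t ∈ cell d ξ η, ∀ s ∈ cell d ξ η,
        Summable (fun p : west2 => image β d ξ η t s p) ∧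
        Summable (fun p : east2 => image β d ξ η t s p) ∧
        ∀ a b : Fin 2,
          Integrable (fun lam => integrand2 β d ξ η (chi β) (symbB β) t s lam a b) ∧
          Integrable (fun lam => integrand2 β d ξ η abs symbZ t s lam a b) ∧
          ((kernel west2 β d ξ η t s a b : ℝ) : ℂ) =
            (∫ lam, integrand2 β d ξ η (chi β) (symbB β) t s lam a b)
              + ∫ lam, integrand2 β d ξ η abs symbZ t s lam a b) ∧
      (∀ ε : ℝ, 0 < ε →
        (∃ QB : Rule, ∀ ξ : ℝ, Real.sqrt (ξ ^ 2 + η ^ 2) ≤ d →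
          QB.Precise ε (cell d ξ η) (integrand2 β d ξ η (chi β) (symbB β))) ∧
        (∃ QZ : Rule, (∀ n, QZ.node n ≠ 0) ∧ ∀ ξ : ℝ, Real.sqrt (ξ ^ 2 + η ^ 2) ≤ d →
          QZ.Precise ε (cell d ξ η) (integrand2 β d ξ η abs symbZ))) ∧
      (∀ ξ : ℝ, Real.sqrt (ξ ^ 2 + η ^ 2) ≤ d →
        ∀ ε : ℝ, 0 < ε → ∀ QB QZ : Rule,
        QB.Precise ε (cell d ξ η) (integrand2 β d ξ η (chi β) (symbB β)) →
        (∀ n, QZ.node n ≠ 0) →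
        QZ.Precise ε (cell d ξ η) (integrand2 β d ξ η abs symbZ) →
        ∀ (NT NS : ℕ) (T : Fin NT → ℝ × ℝ) (S : Fin NS → ℝ × ℝ),
          (∀ l, T l ∈ cell d ξ η) → (∀ j, S j ∈ cell d ξ η) →
          RealPartApprox (periodizing west2 β d ξ η T S)
            (lowRankWest2 β d ξ η QB QZ T S) (2 * ε) ∧
          RealPartApprox (periodizing east2 β d ξ η T S)
            (lowRankEast2 β d ξ η QB QZ T S) (2 * ε))) := by
  -- The length condition enters through |ξ| ≤ d, which bounds the offset of the neighbouring rows
  -- and makes the range of ξ compact.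
  have hξ : ∀ ξ : ℝ, Real.sqrt (ξ ^ 2 + η ^ 2) ≤ d → ξ ∈ Set.Icc (-d) d := fun ξ h =>
    abs_le.1 ((Real.abs_le_sqrt (by nlinarith [sq_nonneg η])).trans h)
  have h0 : (0 : ℝ) ∈ Set.Icc (-0 : ℝ) 0 := by simp
  have hJ1 : ∀ n ∈ ({0} : Finset ℤ), -n ∈ ({0} : Finset ℤ) := by simp
  have hJ2 : ∀ n ∈ Finset.Icc (-1 : ℤ) 1, -n ∈ Finset.Icc (-1 : ℤ) 1 := fun n hn => by
    rw [Finset.mem_Icc] at hn ⊢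
    omega
  have hs1 := separated_cell (separated_single (η := η) hd) h0
  have hs2 := fun ξ h => separated_cell (separated_double (η := η) hd) (hξ ξ h)
  simp only [lowRankWest1, lowRankEast1, lowRankWest2, lowRankEast2, integrand1_eq β d η,
    diag1_eq β d η, integrand2_eq, diag2_eq]
  rw [west1_eq, east1_eq, west2_eq, east2_eq]
  refine ⟨⟨fun t ht s hs => kernel_expansion hβ hd hJ1 (hs1 t ht s hs) (hs1 s hs t ht),
    fun ε hε => ⟨?_, ?_⟩, fun ε _ QB QZ hQB _ hQZ NT NS T S hT hS =>
      realPartApprox_cells hβ hd hJ1 hs1 hQB hQZ hT hS⟩,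
    fun ξ h t ht s hs => kernel_expansion hβ hd hJ2 (hs2 ξ h t ht s hs) (hs2 ξ h s hs t ht),
    fun ε hε => ⟨?_, ?_⟩, fun ξ h ε _ QB QZ hQB _ hQZ NT NS T S hT hS =>
      realPartApprox_cells hβ hd hJ2 (hs2 ξ h) hQB hQZ hT hS⟩
  · obtain ⟨Q, -, hQ⟩ := exists_rule_cell hd (isSymbol_symbB hβ) (separated_single hd) hε
    exact ⟨Q, hQ 0 h0⟩
  · obtain ⟨Q, hQ0, hQ⟩ := exists_rule_cell hd isSymbol_symbZ (separated_single hd) hε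
    exact ⟨Q, hQ0, hQ 0 h0⟩
  · obtain ⟨Q, -, hQ⟩ := exists_rule_cell hd (isSymbol_symbB hβ) (separated_double hd) hε
    exact ⟨Q, fun ξ h => hQ ξ (hξ ξ h)⟩
  · obtain ⟨Q, hQ0, hQ⟩ := exists_rule_cell hd isSymbol_symbZ (separated_double hd) hε
    exact ⟨Q, hQ0, fun ξ h => hQ ξ (hξ ξ h)⟩
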